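/- All topological groups are $T_1$ (hence completely regular), "countable" means finite or countably infinite, and products carry the product topology. A space $X$ is Fréchet if whenever $x\in\overline A\subseteq X$ there is a sequence in $A$ converging to $x$; it is sequential if every subset that is closed under limits of convergent sequences is closed. An ideal on a set $X$ is a family $\mathcal I\subseteq\mathcal P(X)$ that contains all finite subsets of $X$ and is closed under subsets and finite unions; $\mathcal I^+=\mathcal P(X)\setminus\mathcal I$. A family $\mathcal I$ of subsets of $X$ that is closed under subsets is $\omega$-hitting if for every countable family $\mathcal Y$ of infinite subsets of $X$ there is $I\in\mathcal I$ with $Y\cap I$ infinite for all $Y\in\mathcal Y$. An ideal $\mathcal I$ is tame if for every $Y\in\mathcal I^+$, every $f:Y\to\omega$ and every $\omega$-hitting ideal $\mathcal J$ on $\omega$ there is $J\in\mathcal J$ with $f^{-1}[J]\notin\mathcal I$. An infinite sequence converging to $x$ is identified with a countably infinite set $C$ such that $C\setminus U$ is finite for every neighbourhood $U$ of $x$. An ideal $\mathcal I$ on a topological group $\mathbb G$ is invariant if $gI,\ Ig,\ I^{-1}\in\mathcal I$ for all $I\in\mathcal I$, $g\in\mathbb G$; it is weakly closed if for every $A\subseteq\mathbb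 G$ and every infinite sequence $C$ converging to $1_{\mathbb G}$, $$A\in\mathcal I\iff A\cup\{x\in\mathbb G: Cx\setminus A\text{ is finite}\}\in\mathcal I.$$ A subset $Y$ of a space $X$ is entangled if for every $x\in X$ the family $\{A\subseteq Y: x\notin\overline A\}$ of subsets of $Y$ is $\omega$-hitting on $Y$; $X$ is groomed if it has no dense entangled subset. The Invariant Ideal Axiom (IIA) is the statement: for every countable groomed topological group $\mathbb G$ and every tame, weakly closed, invariant ideal $\mathcal I$ on $\mathbb G$, at least one of the following holds: (a) there is a countable $\mathcal S\subseteq\mathcal I$ such that for every infinite sequence $C$ convergent in $\mathbb G$ there is $I\in\mathcal S$ with $C\cap I$ infinite; (b) there is a countable $\mathcal H\subseteq\mathcal I^+$ such that for every non-empty open $U\subseteq\mathbb G$ there is $H\in\mathcal H$ with $H\setminus U\in\mathcal I$. **Corollary.** Assume IIA. Then: 1. The product of at most countably many separable Fréchet topological groups is Fréchet. 2. The product of finitely many countable sequential topological groups, each of which is either discrete or not Fréchet, is sequential. -/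

import Mathlib

open Topology

/-- `C` is an infinite (one-to-one) sequence, regarded as a set of points, converging to `x`:
it is countably infinite and almost contained in every neighbourhood of `x`. -/
structure SeqConvergesTo {X : Type*} [TopologicalSpace X] (C : Set X) (x : X) : Prop where
  infinite : C.Infinite
  countable : C.Countable
  almost_subset : ∀ U ∈ 𝓝 x, (C \ U).Finite

/-- Ideals of subsets of `X`; all ideals contain all finite sets. -/
structure IsSetIdeal {X : Type*} (I : Set (Set X)) : Prop where
  finite_mem : ∀ A : Set X, A.Finite → A ∈ I
  subset_mem : ∀ A B : Set X, A ∈ I → B ⊆ A → B ∈ I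
  union_mem : ∀ A B : Set X, A ∈ I → B ∈ I → A ∪ B ∈ I

/-- The restriction to `Y` of the downward closed family `I` is `ω`-hitting (as a family of
subsets of `Y`). -/
def IsOmegaHittingOn {X : Type*} (I : Set (Set X)) (Y : Set X) : Prop :=
  ∀ F : Set (Set X), F.Countable → (∀ Z ∈ F, Z ⊆ Y ∧ Z.Infinite) →
    ∃ A ∈ I, ∀ Z ∈ F, (Z ∩ A).Infinite

/-- `ω`-hitting families of subsets of `X`. -/
def IsOmegaHitting {X : Type*} (I : Set (Set X)) : Prop :=
  IsOmegaHittingOn I Set.univ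

/-- An ideal `I` is tame if for every `I`-positive `Y`, every `f : Y → ℕ` (given here as the
restriction to `Y` of a function on `X`) and every `ω`-hitting ideal `J` on `ℕ`, some member
of `J` has an `I`-positive preimage in `Y`. -/
def IsTame {X : Type*} (I : Set (Set X)) : Prop :=
  ∀ Y : Set X, Y ∉ I → ∀ f : X → ℕ, ∀ J : Set (Set ℕ), IsSetIdeal J → IsOmegaHitting J →
    ∃ A ∈ J, Y ∩ f ⁻¹' A ∉ I

/-- Invariance of a family of subsets of a group under both translations and inversion. -/
structure IsInvariantFamily {G : Type*} [Group G] (I : Set (Set G)) : Prop where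
  mul_left : ∀ (g : G), ∀ A ∈ I, (fun h => g * h) '' A ∈ I
  mul_right : ∀ (g : G), ∀ A ∈ I, (fun h => h * g) '' A ∈ I
  inv : ∀ A ∈ I, (fun h => h⁻¹) '' A ∈ I

/-- `I` is weakly closed: for every `A` and every sequence `C` converging to `1`, `A` is in `I`
if and only if `A ∪ {x | C · x ⊆* A}` is in `I`. -/
def IsWeaklyClosed {G : Type*} [Group G] [TopologicalSpace G] (I : Set (Set G)) : Prop :=
  ∀ A C : Set G, SeqConvergesTo C 1 →
    (A ∈ I ↔ A ∪ {x | ((fun c => c * x) '' C \ A).Finite} ∈ I)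

/-- The family of all sets whose closure misses `x`. -/
def pointIdeal {X : Type*} [TopologicalSpace X] (x : X) : Set (Set X) :=
  {A | x ∉ closure A}

/-- `Y` is entangled in `X`. -/
def IsEntangled {X : Type*} [TopologicalSpace X] (Y : Set X) : Prop :=
  ∀ x : X, IsOmegaHittingOn (pointIdeal x) Y

/-- A space is groomed if it has no dense entangled subset. -/
def IsGroomed (X : Type*) [TopologicalSpace X] : Prop :=
  ¬ ∃ Y : Set X, Dense Y ∧ IsEntangled Y

/-- A countable sequence capturing subfamily of `I` exists. -/
def HasSeqCapturing {X : Type*} [TopologicalSpace X] (I : Set (Set X)) : Prop :=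
  ∃ S : Set (Set X), S.Countable ∧ S ⊆ I ∧
    ∀ (C : Set X) (x : X), SeqConvergesTo C x → ∃ A ∈ S, (C ∩ A).Infinite

/-- A countable almost `π`-network of `I`-positive sets exists. -/
def HasAlmostPiNetwork {X : Type*} [TopologicalSpace X] (I : Set (Set X)) : Prop :=
  ∃ H : Set (Set X), H.Countable ∧ (∀ A ∈ H, A ∉ I) ∧
    ∀ U : Set X, IsOpen U → U.Nonempty → ∃ A ∈ H, A \ U ∈ I

/-- The Invariant Ideal Axiom. Groups are `T₁` (hence completely regular); as they are
countable, it suffices to quantify over the groups in the lowest universe. -/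
def InvariantIdealAxiom : Prop :=
  ∀ (G : Type) [Group G] [TopologicalSpace G] [IsTopologicalGroup G] [T1Space G] [Countable G],
    IsGroomed G →
    ∀ I : Set (Set G), IsSetIdeal I → IsTame I → IsWeaklyClosed I → IsInvariantFamily I →
      HasSeqCapturing I ∨ HasAlmostPiNetwork I

/-! In a nondiscrete countable sequential group the nowhere dense sets form an invariant, weakly
closed ideal. If it is tame, the axiom gives either a countable base at 1 or countably many nowhere
dense sets capturing all convergent sequences; if it is not tame, that failure itself yields such
sets (`isCountablyGenerated_or_exists_capturing`).

A Fréchet space without isolated points is never captured in this way, so countable Fréchet groups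
are first countable. Separable ones inherit a countable base at 1 from a countable dense subgroup,
and countable products preserve first countability.

In a non-Fréchet group the capturing alternative holds and produces an increasing scale `F`. The
axiom is applied again, to the ideal of sets whose closure contains no sequence movable off some `F
m` by small translations (`immovableIdeal`). This ideal has no almost π-network, so countably many
immovable sets capture all convergent sequences. Closures of immovable sets are locally compact
(`exists_nhds_forall_not_isEscaping`), so countably many compact sets capture as well and the group
is a k_ω-space. Finite products of regular k_ω-spaces are k_ω, and countable Hausdorff k_ω-spaces
are sequential. -/

open Filter Set

/-! ### Convergent sequences and groomed spaces. -/

section Sequences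

variable {X : Type*} [TopologicalSpace X]

theorem SeqConvergesTo.of_tendsto {u : ℕ → X} {x : X} (hu : Tendsto u atTop (𝓝 x))
    (hi : (range u).Infinite) : SeqConvergesTo (range u) x := by
  refine ⟨hi, countable_range u, fun U hU => ?_⟩
  have h : {n | ¬ u n ∈ U}.Finite := by
    have := hu.eventually_mem hU
    rwa [← Nat.cofinite_eq_atTop, Filter.eventually_cofinite] at this
  refine (h.image u).subset ?_
  rintro _ ⟨⟨n, rfl⟩, hn⟩
  exact ⟨n, hn, rfl⟩

theorem SeqConvergesTo.mono {C D : Set X} {x : X} (hC : SeqConvergesTo C x) (hD : D ⊆ C)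
    (hi : D.Infinite) : SeqConvergesTo D x :=
  ⟨hi, hC.countable.mono hD, fun U hU => (hC.almost_subset U hU).subset (sdiff_subset_sdiff_left hD)⟩

theorem SeqConvergesTo.exists_seq {C : Set X} {x : X} (hC : SeqConvergesTo C x) :
    ∃ u : ℕ → X, Function.Injective u ∧ range u = C ∧ Tendsto u atTop (𝓝 x) := by
  have := hC.countable.to_subtype
  have := hC.infinite.to_subtype
  obtain ⟨e⟩ := nonempty_equiv_of_countable (α := ℕ) (β := C)
  refine ⟨fun n => e n, Subtype.val_injective.comp e.injective, ?_, ?_⟩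
  · ext y
    constructor
    · rintro ⟨n, rfl⟩
      exact (e n).2
    · intro hy
      exact ⟨e.symm ⟨y, hy⟩, by simp⟩
  · rw [tendsto_def]
    intro U hU
    rw [← Nat.cofinite_eq_atTop, mem_cofinite]
    refine ((hC.almost_subset U hU).preimage (f := fun n => (e n : X))
      (Subtype.val_injective.comp e.injective).injOn).subset ?_
    intro n hn
    exact ⟨(e n).2, hn⟩

theorem SeqConvergesTo.mem_closure {C A : Set X} {x : X} (hC : SeqConvergesTo C x)
    (h : (C ∩ A).Infinite) : x ∈ closure A := by
  rw [mem_closure_iff_nhds]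
  intro U hU
  obtain ⟨y, hy, hyU⟩ := h.exists_notMem_finite (hC.almost_subset U hU)
  exact ⟨y, by by_contra hn; exact hyU ⟨hy.1, fun h => hn ⟨h, hy.2⟩⟩⟩

theorem SeqConvergesTo.image {Y : Type*} [TopologicalSpace Y] {C : Set X} {x : X}
    (hC : SeqConvergesTo C x) {f : X → Y} (hf : Continuous f) (hinj : Function.Injective f) :
    SeqConvergesTo (f '' C) (f x) := by
  refine ⟨hC.infinite.image hinj.injOn, hC.countable.image f, fun U hU => ?_⟩
  refine ((hC.almost_subset _ (hf.continuousAt.preimage_mem_nhds hU)).image f).subset ?_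
  rintro _ ⟨⟨y, hy, rfl⟩, hyU⟩
  exact ⟨y, ⟨hy, hyU⟩, rfl⟩

/-- The range of a convergent sequence lying in a set that does not contain the limit is
infinite. -/
theorem infinite_range_of_tendsto [T1Space X] {u : ℕ → X} {x : X} (hu : Tendsto u atTop (𝓝 x))
    (hx : ∀ n, u n ≠ x) : (range u).Infinite := by
  intro hfin
  have : x ∈ range u := by
    rw [← hfin.isClosed.closure_eq]
    exact mem_closure_of_tendsto hu (Eventually.of_forall fun n => mem_range_self n)
  obtain ⟨n, hn⟩ := this
  exact hx n hn

/-- In a sequential `T₁` space a set that contains the limits of its infinite convergent sequences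
is closed. -/
theorem isClosed_of_seqConvergesTo [SequentialSpace X] [T1Space X] {A : Set X}
    (h : ∀ (C : Set X) (x : X), C ⊆ A → SeqConvergesTo C x → x ∈ A) : IsClosed A := by
  rw [← isSeqClosed_iff_isClosed]
  intro u x hu hux
  by_contra hx
  refine hx (h (range u) x (range_subset_iff.2 hu) (.of_tendsto hux ?_))
  exact infinite_range_of_tendsto hux fun n hn => hx (hn ▸ hu n)

/-- An entangled set contains no infinite convergent sequence, since a set hitting the sequence
infinitely often has the limit in its closure. So all its subsets are closed, and if it is dense the
space is discrete. -/
theorem isGroomed_of_sequentialSpace [SequentialSpace X] [T1Space X]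
    (hd : ¬ DiscreteTopology X) : IsGroomed X := by
  rintro ⟨Y, hY, hent⟩
  apply hd
  have key : ∀ A ⊆ Y, IsClosed A := by
    intro A hA
    refine isClosed_of_seqConvergesTo fun C x hC hx => ?_
    obtain ⟨B, hB, hB'⟩ := hent x {C} (countable_singleton C) (by
      rintro _ rfl
      exact ⟨hC.trans hA, hx.infinite⟩)
    exact absurd (hx.mem_closure (hB' C rfl)) hB
  have hu : Y = univ := by rw [← (key Y subset_rfl).closure_eq, hY.closure_eq]
  rw [discreteTopology_iff_forall_isClosed]
  intro A
  exact key A (hu ▸ subset_univ A)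

end Sequences

/-! ### Using `ω`-hitting ideals. -/

/-- An `ω`-hitting ideal on `ℕ` meets infinitely many rows of a matrix infinitely often. -/
theorem IsOmegaHitting.exists_frequently {J : Set (Set ℕ)} (hJ : IsSetIdeal J)
    (hω : IsOmegaHitting J) (s : ℕ → ℕ → ℕ) :
    ∃ A ∈ J, ∃ᶠ m in atTop, ∃ᶠ i in atTop, s m i ∈ A := by
  -- Either infinitely many rows repeat a value forever, and those values are to be hit, or all late
  -- rows have infinite tails, which are hit simultaneously.
  by_cases hP : ∃ᶠ m in atTop, ∃ n, ∃ᶠ i in atTop, s m i = n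
  · obtain ⟨φ, hφ, hφ'⟩ := extraction_of_frequently_atTop hP
    choose n hn using hφ'
    by_cases hfin : (range n).Finite
    · refine ⟨range n, hJ.finite_mem _ hfin, ?_⟩
      rw [frequently_atTop]
      intro a
      exact ⟨φ a, hφ.id_le a, (hn a).mono fun i hi => ⟨a, hi.symm⟩⟩
    · obtain ⟨A, hA, hA'⟩ := hω {range n} (countable_singleton _) (by
        rintro _ rfl
        exact ⟨subset_univ _, hfin⟩)
      refine ⟨A, hA, ?_⟩
      have : {k | n k ∈ A}.Infinite := by
        intro h
        refine hA' _ rfl ((h.image n).subset ?_)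
        rintro _ ⟨⟨k, rfl⟩, hk⟩
        exact ⟨k, hk, rfl⟩
      rw [frequently_atTop]
      intro a
      obtain ⟨k, hk, hak⟩ := this.exists_gt a
      exact ⟨φ k, hak.le.trans (hφ.id_le k), (hn k).mono fun i hi => by rw [hi]; exact hk⟩
  · rw [not_frequently, eventually_atTop] at hP
    obtain ⟨a, ha⟩ := hP
    have hinf : ∀ m ≥ a, ∀ k, (s m '' Ici k).Infinite := by
      intro m hm k hfin
      apply ha m hm
      by_contra! hcon
      have hev : ∀ᶠ i in atTop, ∀ n ∈ s m '' Ici k, s m i ≠ n := by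
        rw [eventually_all_finite hfin]
        intro n _
        exact hcon n
      obtain ⟨i, hi, hik⟩ := (hev.and (eventually_ge_atTop k)).exists
      exact hi _ ⟨i, hik, rfl⟩ rfl
    obtain ⟨A, hA, hA'⟩ := hω {Z | ∃ m ≥ a, ∃ k, Z = s m '' Ici k} (by
      refine (countable_range fun p : ℕ × ℕ => s p.1 '' Ici p.2).mono ?_
      rintro _ ⟨m, _, k, rfl⟩
      exact ⟨(m, k), rfl⟩) (by
      rintro _ ⟨m, hm, k, rfl⟩
      exact ⟨subset_univ _, hinf m hm k⟩)
    refine ⟨A, hA, (eventually_atTop.2 ⟨a, fun m hm => ?_⟩).frequently⟩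
    rw [frequently_atTop]
    intro k
    obtain ⟨_, ⟨i, hi, rfl⟩, hiA⟩ := (hA' _ ⟨m, hm, k, rfl⟩).nonempty
    exact ⟨i, hi, hiA⟩

/-- A function on a set `Y` extends to the closure of `Y` modulo a single member of an
`ω`-hitting ideal. -/
theorem exists_extension_of_isOmegaHitting {X : Type*} [TopologicalSpace X] [SequentialSpace X]
    [T1Space X] [Countable X] (Y : Set X) (f : X → ℕ) {J : Set (Set ℕ)}
    (hω : IsOmegaHitting J) :
    ∃ v : X → ℕ, ∃ A ∈ J,
      (∀ p ∈ closure Y, p ∈ closure (Y ∩ f ⁻¹' A) ∨ p ∈ closure (Y ∩ f ⁻¹' {v p})) ∧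
      (∀ p ∈ closure Y, p ∈ closure (Y ∩ f ⁻¹' A) ∨ p ∈ closure (Y ∩ f ⁻¹' Iic (v p))) ∧
      ∀ (C : Set X) (x : X), SeqConvergesTo C x → (∀ p ∈ C, p ∈ closure (Y ∩ f ⁻¹' Iic (v p))) →
        (∀ j, (C ∩ closure (Y ∩ f ⁻¹' Iic j)).Finite) → x ∈ closure (Y ∩ f ⁻¹' A) := by
  classical
  set R : ℕ → Set X := fun j => closure (Y ∩ f ⁻¹' Iic j) with hR
  -- The least level whose closure contains `p`; the default 0 occurs only where no `R j` contains
  -- `p`.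
  set v : X → ℕ := fun p => if h : ∃ j, p ∈ R j then Nat.find h else 0 with hv
  have hRmono : Monotone R := fun i j hij => closure_mono (by
    intro y hy
    exact ⟨hy.1, le_trans hy.2 hij⟩)
  have hvR : ∀ p, (∃ j, p ∈ R j) → p ∈ R (v p) := by
    intro p hp
    simp only [hv, dif_pos hp]
    exact Nat.find_spec hp
  have hvmin : ∀ p j, p ∈ R j → v p ≤ j := by
    intro p j hp
    have : ∃ j, p ∈ R j := ⟨j, hp⟩
    simp only [hv, dif_pos this]
    exact Nat.find_min' this hp
  -- at a point of `R (v p)`, the value `v p` is attained near `p`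
  have hvval : ∀ p, (∃ j, p ∈ R j) → p ∈ closure (Y ∩ f ⁻¹' {v p}) := by
    intro p hp
    have h1 := hvR p hp
    rcases Nat.eq_zero_or_pos (v p) with h0 | hpos
    · refine closure_mono ?_ h1
      rintro y ⟨hy, hyf⟩
      refine ⟨hy, ?_⟩
      simp only [h0, mem_preimage, mem_Iic, mem_singleton_iff] at hyf ⊢
      omega
    · have h2 : R (v p) ⊆ R (v p - 1) ∪ closure (Y ∩ f ⁻¹' {v p}) := by
        rw [hR]
        dsimp only
        rw [← closure_union]
        refine closure_mono ?_
        rintro y ⟨hy, hyf⟩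
        simp only [mem_preimage, mem_Iic] at hyf
        rcases hyf.lt_or_eq with h | h
        · exact Or.inl ⟨hy, by simp only [mem_preimage, mem_Iic]; omega⟩
        · exact Or.inr ⟨hy, h⟩
      rcases h2 h1 with h | h
      · have := hvmin p _ h
        omega
      · exact h
  -- Along such a `C` the levels `v` tend to infinity. The desired conclusion concerns only the
  -- limit `x`, so one witness `D x` per point is enough, and countably many sets need to be hit.
  set Q : X → Set X → Prop := fun x C =>
    SeqConvergesTo C x ∧ (∀ p ∈ C, p ∈ R (v p)) ∧ ∀ j, (C ∩ R j).Finite with hQ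
  have hQinf : ∀ x C, Q x C → (v '' C).Infinite := by
    rintro x C ⟨h1, h2, h3⟩ hfin
    obtain ⟨b, hb⟩ := hfin.bddAbove
    refine h1.infinite ((h3 b).subset fun p hp => ⟨hp, ?_⟩)
    exact hRmono (hb ⟨p, hp, rfl⟩) (h2 p hp)
  have hex : ∀ x, ∃ C, (∃ D, Q x D) → Q x C := by
    intro x
    by_cases h : ∃ D, Q x D
    · exact ⟨h.choose, fun _ => h.choose_spec⟩
    · exact ⟨∅, fun h' => absurd h' h⟩
  choose D hD using hex
  obtain ⟨A, hA, hA'⟩ := hω {Z | ∃ x, Q x (D x) ∧ Z = v '' D x} (by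
    refine (countable_range fun x => v '' D x).mono ?_
    rintro _ ⟨x, _, rfl⟩
    exact ⟨x, rfl⟩) (by
    rintro _ ⟨x, hx, rfl⟩
    exact ⟨subset_univ _, hQinf x _ hx⟩)
  have hlim : ∀ (C : Set X) (x : X), Q x C → x ∈ closure (Y ∩ f ⁻¹' A) := by
    intro C x hC
    have hx := hD x ⟨C, hC⟩
    have hinf := hA' _ ⟨x, hx, rfl⟩
    rw [← closure_closure]
    refine hx.1.mem_closure (fun hfin => hinf ((hfin.image v).subset ?_))
    rintro _ ⟨⟨p, hp, rfl⟩, hpA⟩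
    refine ⟨p, ⟨hp, ?_⟩, rfl⟩
    refine closure_mono ?_ (hvval p ⟨_, hx.2.1 p hp⟩)
    rintro y ⟨hy, hyf⟩
    refine ⟨hy, ?_⟩
    rw [mem_preimage, mem_singleton_iff.1 hyf]
    exact hpA
  -- A sequence in this union that almost avoids the first set either meets some `R j` infinitely
  -- often or has levels tending to infinity, where `hlim` applies.
  have hclosed : IsClosed (closure (Y ∩ f ⁻¹' A) ∪ {p | ∃ j, p ∈ R j}) := by
    refine isClosed_of_seqConvergesTo fun C x hC hx => ?_
    by_cases h1 : (C ∩ closure (Y ∩ f ⁻¹' A)).Infinite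
    · left
      rw [← closure_closure]
      exact hx.mem_closure h1
    have hCinf : (C \ closure (Y ∩ f ⁻¹' A)).Infinite := by
      rw [← sdiff_inter_self_eq_sdiff, inter_comm]
      exact hx.infinite.sdiff (not_infinite.1 h1)
    set E := C \ closure (Y ∩ f ⁻¹' A) with hE
    have hEx : SeqConvergesTo E x := hx.mono sdiff_subset hCinf
    have hEv : ∀ p ∈ E, p ∈ R (v p) := fun p hp => hvR p ((hC hp.1).resolve_left hp.2)
    by_cases h2 : ∀ j, (E ∩ R j).Finite
    · exact Or.inl (hlim E x ⟨hEx, hEv, h2⟩)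
    · push Not at h2
      obtain ⟨j, hj⟩ := h2
      right
      refine ⟨j, ?_⟩
      have := hEx.mem_closure hj
      rwa [hR, closure_closure] at this
  have hsub : closure Y ⊆ closure (Y ∩ f ⁻¹' A) ∪ {p | ∃ j, p ∈ R j} := by
    refine closure_minimal (fun y hy => Or.inr ⟨f y, subset_closure ⟨hy, ?_⟩⟩) hclosed
    simp
  refine ⟨v, A, hA, fun p hp => (hsub hp).imp_right (hvval p),
    fun p hp => (hsub hp).imp_right (hvR p), ?_⟩
  intro C x h1 h2 h3
  exact hlim C x ⟨h1, h2, h3⟩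

/-! ### Capturing families. -/

/-- A family of sets captures convergent sequences if every infinite convergent sequence has
infinitely many points in one of its members. -/
def IsCapturing {X : Type*} [TopologicalSpace X] (S : Set (Set X)) : Prop :=
  ∀ (C : Set X) (x : X), SeqConvergesTo C x → ∃ A ∈ S, (C ∩ A).Infinite

section Capturing

variable {X : Type*} [TopologicalSpace X]

theorem SeqConvergesTo.unique [T2Space X] {C : Set X} {x y : X} (hx : SeqConvergesTo C x)
    (hy : SeqConvergesTo C y) : x = y := by
  by_contra hne
  obtain ⟨U, V, hU, hV, hxU, hyV, hUV⟩ := t2_separation hne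
  refine hx.infinite (((hx.almost_subset U (hU.mem_nhds hxU)).union
    (hy.almost_subset V (hV.mem_nhds hyV))).subset fun c hc => ?_)
  by_cases hcU : c ∈ U
  · exact Or.inr ⟨hc, hUV.notMem_of_mem_left hcU⟩
  · exact Or.inl ⟨hc, hcU⟩

theorem exists_monotone_cofinal {α : Type*} {P : Set α → Prop} (h0 : P ∅)
    (hu : ∀ A B, P A → P B → P (A ∪ B)) {S : Set (Set α)} (hS : S.Countable)
    (hP : ∀ A ∈ S, P A) :
    ∃ F : ℕ → Set α, Monotone F ∧ (∀ n, P (F n)) ∧ ∀ A ∈ S, ∃ n, A ⊆ F n := by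
  obtain ⟨s, hs⟩ := (hS.insert ∅).exists_eq_range (insert_nonempty _ _)
  have hsP : ∀ n, P (s n) := by
    intro n
    have : s n ∈ insert ∅ S := hs ▸ mem_range_self n
    rcases this with h | h
    · rw [h]; exact h0
    · exact hP _ h
  refine ⟨partialSups s, (partialSups s).monotone, ?_, ?_⟩
  · intro n
    induction n with
    | zero => simpa using hsP 0
    | succ n ih =>
      rw [← Order.succ_eq_add_one, partialSups_succ]
      exact hu _ _ ih (hsP _)
  · intro A hA
    have : A ∈ range s := hs ▸ mem_insert_of_mem _ hA
    obtain ⟨n, rfl⟩ := this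
    exact ⟨n, le_partialSups s n⟩

end Capturing

/-! ### The nowhere dense ideal. -/

section Group

variable {G : Type*} [Group G] [TopologicalSpace G] [IsTopologicalGroup G]

theorem neBot_nhdsNE_of_not_discreteTopology (hd : ¬ DiscreteTopology G) (x : G) :
    NeBot (𝓝[≠] x) := by
  rw [neBot_iff]
  intro h
  apply hd
  have hx : IsOpen ({x} : Set G) := (isOpen_singleton_iff_punctured_nhds x).2 h
  refine discreteTopology_of_isOpen_singleton_one ?_
  have := (Homeomorph.mulLeft x⁻¹).isOpenMap _ hx
  simpa using this

theorem firstCountableTopology_of_isCountablyGenerated (h : (𝓝 (1 : G)).IsCountablyGenerated) :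
    FirstCountableTopology G :=
  ⟨fun x => by
    rw [← map_mul_left_nhds_one]
    infer_instance⟩

/-- If `C * x` is almost contained in `A`, then `x` is a limit of points of `A`; hence the added
points lie in `closure A`. -/
theorem isWeaklyClosed_of_closure_mem {I : Set (Set G)} (hI : IsSetIdeal I)
    (h : ∀ A ∈ I, closure A ∈ I) : IsWeaklyClosed I := by
  intro A C hC
  refine ⟨fun hA => hI.subset_mem _ _ (h A hA) (union_subset subset_closure ?_),
    fun hA => hI.subset_mem _ _ hA subset_union_left⟩
  intro x hx
  have hCx : SeqConvergesTo ((fun c => c * x) '' C) (1 * x) :=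
    hC.image (continuous_mul_const x) (mul_left_injective x)
  rw [one_mul] at hCx
  refine hCx.mem_closure fun hfin => hCx.infinite ?_
  rw [← inter_union_sdiff ((fun c => c * x) '' C) A]
  exact hfin.union hx

theorem isInvariantFamily_of_homeomorph {I : Set (Set G)}
    (h : ∀ (e : G ≃ₜ G), ∀ A ∈ I, e '' A ∈ I) : IsInvariantFamily I :=
  ⟨fun g A hA => h (Homeomorph.mulLeft g) A hA, fun g A hA => h (Homeomorph.mulRight g) A hA,
    fun A hA => h (Homeomorph.inv G) A hA⟩

theorem isSetIdeal_isNowhereDense {X : Type*} [TopologicalSpace X] [T1Space X]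
    [∀ x : X, NeBot (𝓝[≠] x)] : IsSetIdeal {A : Set X | IsNowhereDense A} := by
  refine ⟨fun A hA => ?_, fun A B hA hB => hA.mono hB, fun A B hA hB => ?_⟩
  · rw [mem_ofPred_eq, hA.isClosed.isNowhereDense_iff, interior_eq_empty_iff_dense_compl]
    simpa [compl_eq_univ_sdiff] using dense_univ.sdiff_finite hA
  · rw [mem_ofPred_eq, IsNowhereDense, closure_union,
      interior_union_isClosed_of_interior_empty isClosed_closure hB]
    exact hA

theorem isInvariantFamily_isNowhereDense : IsInvariantFamily {A : Set G | IsNowhereDense A} :=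
  isInvariantFamily_of_homeomorph fun e A hA => by
    rw [mem_ofPred_eq, IsNowhereDense, ← e.image_closure, ← e.image_interior, hA, image_empty]

/-- A small neighbourhood of the identity. -/
theorem exists_isOpen_closure_div_subset {U : Set G} (hU : U ∈ 𝓝 (1 : G)) :
    ∃ V : Set G, IsOpen V ∧ (1 : G) ∈ V ∧ ∀ x ∈ closure V, ∀ y ∈ closure V, x * y⁻¹ ∈ U := by
  obtain ⟨W, hW, hWU⟩ := exists_nhds_split_inv hU
  obtain ⟨K, hK, hKc, hKW⟩ := exists_mem_nhds_isClosed_subset hW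
  refine ⟨interior K, isOpen_interior, mem_interior_iff_mem_nhds.2 hK, ?_⟩
  have : closure (interior K) ⊆ W := (closure_minimal interior_subset hKc).trans hKW
  intro x hx y hy
  rw [← div_eq_mul_inv]
  exact hWU x (this hx) y (this hy)

/-- If `A \ V` is nowhere dense, the interior of `closure A` lies in `closure V`. So the sets `D *
D⁻¹`, with `D` such an interior for `A` in the network, form a base at 1. -/
theorem isCountablyGenerated_of_hasAlmostPiNetwork
    (h : HasAlmostPiNetwork {A : Set G | IsNowhereDense A}) :
    (𝓝 (1 : G)).IsCountablyGenerated := by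
  obtain ⟨H, hH, hpos, hnet⟩ := h
  set O : Set G → Set G := fun A => {z | ∃ x ∈ interior (closure A), ∃ y ∈ interior (closure A),
    x * y⁻¹ = z} with hO
  have hb : (𝓝 (1 : G)).HasBasis (fun A => A ∈ H) O := by
    constructor
    intro U
    constructor
    · intro hU
      obtain ⟨V, hV, h1, hVU⟩ := exists_isOpen_closure_div_subset hU
      obtain ⟨A, hA, hAV⟩ := hnet V hV ⟨1, h1⟩
      have hsub : interior (closure A) ⊆ closure V := by
        have h2 : interior (closure A) \ closure V ⊆ interior (closure (A \ V)) := by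
          refine interior_maximal ?_ (isOpen_interior.sdiff isClosed_closure)
          rintro x ⟨hx, hxV⟩
          have : x ∈ closure (A \ V ∪ V) :=
            closure_mono (by rw [sdiff_union_self]; exact subset_union_left) (interior_subset hx)
          rw [closure_union] at this
          exact this.resolve_right hxV
        rw [show interior (closure (A \ V)) = ∅ from hAV, subset_empty_iff] at h2
        exact sdiff_eq_empty.1 h2
      refine ⟨A, hA, ?_⟩
      rintro _ ⟨x, hx, y, hy, rfl⟩
      exact hVU x (hsub hx) y (hsub hy)
    · rintro ⟨A, hA, hAU⟩
      refine mem_of_superset ?_ hAU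
      obtain ⟨y, hy⟩ := nonempty_iff_ne_empty.2 (hpos A hA)
      have : (fun z => z * y) ⁻¹' interior (closure A) ∈ 𝓝 (1 : G) :=
        (continuous_mul_const y).continuousAt.preimage_mem_nhds
          (by rw [one_mul]; exact isOpen_interior.mem_nhds hy)
      refine mem_of_superset this fun z hz => ⟨z * y, hz, y, hy, by simp⟩
  exact HasCountableBasis.isCountablyGenerated ⟨hb, hH⟩

/-- A witness of non-tameness makes every `R j` nowhere dense, and some `g` interior to `closure Y`
is off the closure of `Y ∩ f ⁻¹' A`. A sequence translated to converge to `g` meets some `R j`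
infinitely often, as levels tending to infinity would put `g` in that closure. -/
theorem exists_capturing_of_not_isTame [T1Space G] [Countable G] [SequentialSpace G]
    (hd : ¬ DiscreteTopology G) (h : ¬ IsTame {A : Set G | IsNowhereDense A}) :
    ∃ S : Set (Set G), S.Countable ∧ (∀ A ∈ S, IsClosed A ∧ interior A = ∅) ∧ IsCapturing S := by
  have := neBot_nhdsNE_of_not_discreteTopology hd
  simp only [IsTame, not_forall, not_exists, not_and, not_not, mem_ofPred_eq] at h
  obtain ⟨Y, hY, f, J, hJ, hω, hJY⟩ := h
  obtain ⟨v, A, hA, -, h1, h2⟩ := exists_extension_of_isOmegaHitting Y f hω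
  set R : ℕ → Set G := fun j => closure (Y ∩ f ⁻¹' Iic j) with hR
  have hRint : ∀ j, interior (R j) = ∅ := fun j => hJY _ (hJ.finite_mem _ (finite_Iic j))
  set V := interior (closure Y) \ closure (Y ∩ f ⁻¹' A) with hV
  have hVo : IsOpen V := isOpen_interior.sdiff isClosed_closure
  have hVne : V.Nonempty := by
    by_contra hne
    rw [not_nonempty_iff_eq_empty, hV, sdiff_eq_empty] at hne
    apply hY
    have := interior_maximal hne isOpen_interior
    rw [show interior (closure (Y ∩ f ⁻¹' A)) = ∅ from hJY A hA] at this
    exact subset_empty_iff.1 this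
  obtain ⟨g, hg⟩ := hVne
  refine ⟨range fun p : G × ℕ => Homeomorph.mulLeft p.1 '' R p.2, countable_range _, ?_, ?_⟩
  · rintro _ ⟨⟨a, j⟩, rfl⟩
    refine ⟨(Homeomorph.mulLeft a).isClosedMap _ isClosed_closure, ?_⟩
    dsimp only
    rw [← Homeomorph.image_interior, hRint, image_empty]
  · intro C x hC
    have hC' := hC.image (continuous_const_mul (g * x⁻¹)) (mul_right_injective (g * x⁻¹))
    rw [inv_mul_cancel_right] at hC'
    set C' := (fun c => g * x⁻¹ * c) '' C with hC'def
    have hEinf : (C' ∩ V).Infinite := by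
      intro hfin
      refine hC'.infinite ?_
      rw [← inter_union_sdiff C' V]
      exact hfin.union (hC'.almost_subset V (hVo.mem_nhds hg))
    have hE := hC'.mono inter_subset_left hEinf
    have : ∃ j, (C' ∩ V ∩ R j).Infinite := by
      by_contra! hcon
      refine hg.2 (h2 _ g hE (fun p hp => ?_) hcon)
      exact (h1 p (interior_subset hp.2.1)).resolve_left hp.2.2
    obtain ⟨j, hj⟩ := this
    refine ⟨_, ⟨((g * x⁻¹)⁻¹, j), rfl⟩, ?_⟩
    refine (hj.image (mul_right_injective (g * x⁻¹)⁻¹).injOn).mono ?_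
    rintro _ ⟨_, ⟨⟨⟨c, hc, rfl⟩, -⟩, hy⟩, rfl⟩
    refine ⟨?_, mem_image_of_mem _ hy⟩
    simpa [mul_assoc] using hc

/-- Under the axiom a countable sequential group is first countable or its convergent sequences
are captured by countably many nowhere dense sets. -/
theorem isCountablyGenerated_or_exists_capturing (hIIA : InvariantIdealAxiom) {G : Type} [Group G]
    [TopologicalSpace G] [IsTopologicalGroup G] [T1Space G] [Countable G] [SequentialSpace G]
    (hd : ¬ DiscreteTopology G) :
    (𝓝 (1 : G)).IsCountablyGenerated ∨
    ∃ S : Set (Set G), S.Countable ∧ (∀ A ∈ S, IsClosed A ∧ interior A = ∅) ∧ IsCapturing S := by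
  have := neBot_nhdsNE_of_not_discreteTopology hd
  by_cases ht : IsTame {A : Set G | IsNowhereDense A}
  · rcases hIIA G (isGroomed_of_sequentialSpace hd) _ isSetIdeal_isNowhereDense ht
      (isWeaklyClosed_of_closure_mem isSetIdeal_isNowhereDense fun A hA => hA.closure)
      isInvariantFamily_isNowhereDense with ⟨S, hS, hSI, hSC⟩ | h
    · right
      refine ⟨closure '' S, hS.image _, ?_, ?_⟩
      · rintro _ ⟨A, hA, rfl⟩
        exact ⟨isClosed_closure, hSI hA⟩
      · intro C x hC
        obtain ⟨A, hA, hCA⟩ := hSC C x hC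
        exact ⟨_, ⟨A, hA, rfl⟩, hCA.mono (inter_subset_inter_right _ subset_closure)⟩
    · exact Or.inl (isCountablyGenerated_of_hasAlmostPiNetwork h)
  · exact Or.inr (exists_capturing_of_not_isTame hd ht)

/-- In a Fréchet space without isolated points, countably many nowhere dense sets never capture all
convergent sequences. -/
theorem not_isCapturing_of_frechetUrysohnSpace {X : Type*} [TopologicalSpace X] [T2Space X]
    [FrechetUrysohnSpace X] [∀ x : X, NeBot (𝓝[≠] x)] [Nonempty X] {S : Set (Set X)}
    (hS : S.Countable) (hcl : ∀ A ∈ S, IsClosed A ∧ interior A = ∅) : ¬ IsCapturing S := by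
  intro hcap
  obtain ⟨F, hmono, hF, hSF⟩ := exists_monotone_cofinal
    (P := fun A : Set X => IsClosed A ∧ interior A = ∅) ⟨isClosed_empty, interior_empty⟩
    (fun A B hA hB => ⟨hA.1.union hB.1, by
      rw [interior_union_isClosed_of_interior_empty hA.1 hB.2, hA.2]⟩) hS hcl
  obtain ⟨o⟩ := ‹Nonempty X›
  have hdense : ∀ (n : ℕ) (z : X), z ∈ closure ((F n)ᶜ \ {o}) := fun n z =>
    ((interior_eq_empty_iff_dense_compl.1 (hF n).2).sdiff_finite (finite_singleton o)) z
  obtain ⟨x, hxo, hx⟩ := mem_closure_iff_seq_limit.1 (dense_compl_singleton o o)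
  -- The `n`-th sequence avoids `F n`, so `F k` meets only those of index below `k`. A sequence to
  -- `o` captured by `F k` then shares infinitely many points with one of them, forcing `x n = o`.
  have hex : ∀ n, ∃ c : ℕ → X, (∀ a, c a ∈ (F n)ᶜ \ {o}) ∧ Tendsto c atTop (𝓝 (x n)) := fun n =>
    mem_closure_iff_seq_limit.1 (hdense n (x n))
  choose c hc hcx using hex
  have ho : o ∈ closure (range fun p : ℕ × ℕ => c p.1 p.2) := by
    rw [← closure_closure]
    refine mem_closure_of_tendsto hx (Eventually.of_forall fun n => ?_)
    exact mem_closure_of_tendsto (hcx n) (Eventually.of_forall fun a => ⟨(n, a), rfl⟩)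
  obtain ⟨y, hy, hyo⟩ := mem_closure_iff_seq_limit.1 ho
  have hyC : SeqConvergesTo (range y) o := .of_tendsto hyo (infinite_range_of_tendsto hyo fun n => by
    obtain ⟨p, hp⟩ := hy n
    rw [← hp]
    exact (hc _ _).2)
  obtain ⟨A, hA, hAinf⟩ := hcap _ _ hyC
  obtain ⟨k, hk⟩ := hSF A hA
  have hsub : range y ∩ A ⊆ ⋃ n ∈ Iio k, range y ∩ A ∩ range (c n) := by
    rintro _ ⟨⟨i, rfl⟩, hi⟩
    obtain ⟨⟨n, a⟩, hp⟩ := hy i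
    simp only [mem_iUnion]
    refine ⟨n, ?_, ⟨⟨i, rfl⟩, hi⟩, ⟨a, hp⟩⟩
    by_contra hn
    rw [mem_Iio, not_lt] at hn
    refine (hc n a).1 (hmono hn (hk ?_))
    simp only at hp
    rwa [hp]
  have : ∃ n, (range y ∩ A ∩ range (c n)).Infinite := by
    by_contra! hcon
    exact hAinf (((finite_Iio k).biUnion fun n _ => hcon n).subset hsub)
  obtain ⟨n, hn⟩ := this
  refine hxo n ((SeqConvergesTo.of_tendsto (hcx n) (hn.mono inter_subset_right)).mono
    inter_subset_right hn |>.unique (hyC.mono (inter_subset_left.trans inter_subset_left) hn))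

theorem isCountablyGenerated_of_frechetUrysohnSpace (hIIA : InvariantIdealAxiom) {G : Type}
    [Group G] [TopologicalSpace G] [IsTopologicalGroup G] [T1Space G] [Countable G]
    [FrechetUrysohnSpace G] : (𝓝 (1 : G)).IsCountablyGenerated := by
  by_cases hd : DiscreteTopology G
  · infer_instance
  · have := neBot_nhdsNE_of_not_discreteTopology hd
    refine (isCountablyGenerated_or_exists_capturing hIIA hd).resolve_right ?_
    rintro ⟨S, hS, hcl, hcap⟩
    exact not_isCapturing_of_frechetUrysohnSpace hS hcl hcap

end Group

/-! ### Capturing scales and the immovable ideal. -/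

section Scale

variable {G : Type*} [Group G] [TopologicalSpace G]

/-- An increasing sequence of closed nowhere dense sets that covers the group, captures convergent
sequences, and is cofinally invariant under translations and inversion. -/
structure IsCapturingScale (F : ℕ → Set G) : Prop where
  mono : Monotone F
  isClosed : ∀ n, IsClosed (F n)
  interior_eq : ∀ n, interior (F n) = ∅
  capturing : ∀ (C : Set G) (x : G), SeqConvergesTo C x → ∃ n, (C ∩ F n).Infinite
  covering : ∀ x, ∃ n, x ∈ F n
  translate : ∀ g h n, ∃ m, ∀ x ∈ F n, g * x * h ∈ F m
  inv : ∀ n, ∃ m, ∀ x ∈ F n, x⁻¹ ∈ F m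

/-- The homeomorphisms `x ↦ g * x * h` and `x ↦ g * x⁻¹ * h`. -/
def twoSided [IsTopologicalGroup G] (g h : G) : Bool → G ≃ₜ G
  | true => (Homeomorph.mulLeft g).trans (Homeomorph.mulRight h)
  | false => (Homeomorph.inv G).trans ((Homeomorph.mulLeft g).trans (Homeomorph.mulRight h))

theorem twoSided_comp [IsTopologicalGroup G] (g h : G) (b : Bool) (g' h' : G) (b' : Bool) :
    ∃ (k l : G) (c : Bool), ∀ x, twoSided g h b (twoSided g' h' b' x) = twoSided k l c x := by
  cases b <;> cases b'
  · exact ⟨g * h'⁻¹, g'⁻¹ * h, true, fun x => by simp [twoSided, mul_assoc]⟩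
  · exact ⟨g * h'⁻¹, g'⁻¹ * h, false, fun x => by simp [twoSided, mul_assoc]⟩
  · exact ⟨g * g', h' * h, false, fun x => by simp [twoSided, mul_assoc]⟩
  · exact ⟨g * g', h' * h, true, fun x => by simp [twoSided, mul_assoc]⟩

theorem exists_isCapturingScale [IsTopologicalGroup G] [T1Space G] [Countable G]
    (hd : ¬ DiscreteTopology G) {S : Set (Set G)} (hS : S.Countable)
    (hcl : ∀ A ∈ S, IsClosed A ∧ interior A = ∅) (hcap : IsCapturing S) :
    ∃ F : ℕ → Set G, IsCapturingScale F := by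
  have := neBot_nhdsNE_of_not_discreteTopology hd
  -- The translates of `{1}` make the scale cover the group.
  set S' : Set (Set G) :=
    (fun p : (G × G × Bool) × Set G => twoSided p.1.1 p.1.2.1 p.1.2.2 ⁻¹' p.2) ''
      (univ ×ˢ insert {1} S) with hS'
  have hS'c : S'.Countable := (countable_univ.prod (hS.insert {1})).image _
  have hmem : ∀ g h b, ∀ A ∈ insert {1} S, twoSided g h b ⁻¹' A ∈ S' := fun g h b A hA =>
    ⟨((g, h, b), A), ⟨mem_univ _, hA⟩, rfl⟩
  -- The property requires each two-sided preimage to be covered by finitely many members of `S'`.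
  -- It survives finite unions, and cofinality later absorbs such a cover into one `F n`.
  obtain ⟨F, hmono, hF, hSF⟩ := exists_monotone_cofinal
    (P := fun A : Set G => (IsClosed A ∧ interior A = ∅) ∧ ∀ g h b, ∃ T : Set (Set G), T.Finite ∧
      T ⊆ S' ∧ twoSided g h b ⁻¹' A ⊆ ⋃₀ T)
    ⟨⟨isClosed_empty, interior_empty⟩, fun g h b => ⟨∅, finite_empty, empty_subset _, by simp⟩⟩
    (fun A B hA hB => ⟨⟨hA.1.1.union hB.1.1, by
      rw [interior_union_isClosed_of_interior_empty hA.1.1 hB.1.2, hA.1.2]⟩, fun g h b => by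
        obtain ⟨T, h1, h2, h3⟩ := hA.2 g h b
        obtain ⟨T', h1', h2', h3'⟩ := hB.2 g h b
        refine ⟨T ∪ T', h1.union h1', union_subset h2 h2', ?_⟩
        rw [preimage_union, sUnion_union]
        exact union_subset_union h3 h3'⟩) hS'c (by
      rintro _ ⟨⟨⟨g, h, b⟩, A⟩, ⟨-, hA⟩, rfl⟩
      dsimp only at hA ⊢
      have hA' : IsClosed A ∧ interior A = ∅ := by
        rcases hA with rfl | hA
        · exact ⟨isClosed_singleton, interior_singleton 1⟩
        · exact hcl A hA
      refine ⟨⟨hA'.1.preimage (twoSided g h b).continuous, ?_⟩, fun g' h' b' => ?_⟩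
      · rw [← Homeomorph.preimage_interior, hA'.2, preimage_empty]
      · obtain ⟨k, l, c, hk⟩ := twoSided_comp g h b g' h' b'
        refine ⟨{twoSided k l c ⁻¹' A}, finite_singleton _, ?_, ?_⟩
        · rw [singleton_subset_iff]
          exact hmem k l c A hA
        · rw [sUnion_singleton]
          intro x hx
          rw [mem_preimage, ← hk]
          exact hx)
  have hfin : ∀ T : Set (Set G), T.Finite → T ⊆ S' → ∃ n, ⋃₀ T ⊆ F n := by
    intro T hT
    refine hT.induction_on T (fun _ => ⟨0, by simp⟩) ?_
    intro A T' hA hT' ih hsub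
    obtain ⟨n, hn⟩ := ih ((subset_insert _ _).trans hsub)
    obtain ⟨m, hm⟩ := hSF A (hsub (mem_insert _ _))
    refine ⟨max m n, ?_⟩
    rw [sUnion_insert]
    exact union_subset (hm.trans (hmono (le_max_left _ _))) (hn.trans (hmono (le_max_right _ _)))
  have htr : ∀ g h b n, ∃ n', twoSided g h b ⁻¹' F n ⊆ F n' := by
    intro g h b n
    obtain ⟨T, h1, h2, h3⟩ := (hF n).2 g h b
    obtain ⟨n', hn'⟩ := hfin T h1 h2
    exact ⟨n', h3.trans hn'⟩
  refine ⟨F, hmono, fun n => (hF n).1.1, fun n => (hF n).1.2, ?_, ?_, ?_, ?_⟩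
  · intro C x hC
    obtain ⟨A, hA, hCA⟩ := hcap C x hC
    obtain ⟨n, hn⟩ := hSF _ (hmem 1 1 true A (mem_insert_of_mem _ hA))
    refine ⟨n, hCA.mono (inter_subset_inter_right _ (Subset.trans ?_ hn))⟩
    intro x hx
    simpa [twoSided] using hx
  · intro x
    obtain ⟨n, hn⟩ := hSF _ (hmem x⁻¹ 1 true {1} (mem_insert _ _))
    exact ⟨n, hn (by simp [twoSided])⟩
  · intro g h n
    obtain ⟨n', hn'⟩ := htr g⁻¹ h⁻¹ true n
    exact ⟨n', fun x hx => hn' (by simpa [twoSided, mul_assoc] using hx)⟩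
  · intro n
    obtain ⟨n', hn'⟩ := htr 1 1 false n
    exact ⟨n', fun x hx => hn' (by simpa [twoSided] using hx)⟩

/-- The sequence `e` can be moved off `F` by arbitrarily small two-sided translations, into a single
closed set. -/
def IsMovable (F : Set G) (e : ℕ → G) : Prop :=
  ∃ Z : Set G, IsClosed Z ∧ Disjoint Z F ∧
    ∀ V ∈ 𝓝 (1 : G), ∃ r ∈ V, ∃ w ∈ V, ∀ᶠ i in atTop, r * e i * w ∈ Z

theorem IsMovable.comp {F : Set G} {e : ℕ → G} (h : IsMovable F e) {φ : ℕ → ℕ}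
    (hφ : Tendsto φ atTop atTop) : IsMovable F (e ∘ φ) := by
  obtain ⟨Z, h1, h2, h3⟩ := h
  refine ⟨Z, h1, h2, fun V hV => ?_⟩
  obtain ⟨r, hr, w, hw, hrw⟩ := h3 V hV
  exact ⟨r, hr, w, hw, hφ.eventually hrw⟩

theorem IsMovable.anti {F F' : Set G} {e : ℕ → G} (h : IsMovable F' e) (hF : F ⊆ F') :
    IsMovable F e := by
  obtain ⟨Z, h1, h2, h3⟩ := h
  exact ⟨Z, h1, h2.mono_right hF, h3⟩

/-- Intended for translations and inversion: conjugation by a fixed element keeps `r` and `w` small,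
and inversion exchanges the sides, which is why movability is two-sided. -/
theorem IsMovable.of_comp {F F' : Set G} {e : ℕ → G} {φ : G → G} (hφ : Continuous φ)
    (hF : ∀ x ∈ F, φ x ∈ F')
    (hV : ∀ V ∈ 𝓝 (1 : G), ∃ V' ∈ 𝓝 (1 : G), ∀ r ∈ V', ∀ w ∈ V', ∃ r' ∈ V, ∃ w' ∈ V,
      ∀ x, φ (r' * x * w') = r * φ x * w) (h : IsMovable F' (φ ∘ e)) : IsMovable F e := by
  obtain ⟨Z, h1, h2, h3⟩ := h
  refine ⟨φ ⁻¹' Z, h1.preimage hφ, ?_, fun V hVm => ?_⟩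
  · rw [disjoint_left] at h2 ⊢
    exact fun x hx hxF => h2 hx (hF x hxF)
  · obtain ⟨V', hV', hVV⟩ := hV V hVm
    obtain ⟨r, hr, w, hw, hrw⟩ := h3 V' hV'
    obtain ⟨r', hr', w', hw', heq⟩ := hVV r hr w hw
    refine ⟨r', hr', w', hw', hrw.mono fun i hi => ?_⟩
    rw [mem_preimage, heq]
    exact hi

/-- The sets whose closure contains no sequence movable off a fixed member of the scale. -/
def immovableIdeal (F : ℕ → Set G) : Set (Set G) :=
  {A | ∃ m, ∀ e : ℕ → G, (∀ i, e i ∈ closure A) → ¬ IsMovable (F m) e}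

theorem notMem_immovableIdeal {F : ℕ → Set G} {A : Set G} :
    A ∉ immovableIdeal F ↔ ∀ m, ∃ e : ℕ → G, (∀ i, e i ∈ closure A) ∧ IsMovable (F m) e := by
  simp [immovableIdeal]

theorem closure_mem_immovableIdeal {F : ℕ → Set G} {A : Set G} (hA : A ∈ immovableIdeal F) :
    closure A ∈ immovableIdeal F := by
  obtain ⟨m, hm⟩ := hA
  exact ⟨m, by rwa [closure_closure]⟩

/-- Take for each `m` a sequence in `closure Y` movable off `F m`, and extend `f` to `closure Y` by
`v`. Some member of `J` catches infinitely many `v`-values on infinitely many of these sequences; as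
`F` increases, infinitely many `m` suffice. -/
theorem isTame_immovableIdeal [T1Space G] [Countable G] [SequentialSpace G] {F : ℕ → Set G}
    (hF : Monotone F) : IsTame (immovableIdeal F) := by
  intro Y hY f J hJ hω
  rw [notMem_immovableIdeal] at hY
  choose e heY he using hY
  obtain ⟨v, A₀, hA₀, hv, -, -⟩ := exists_extension_of_isOmegaHitting Y f hω
  obtain ⟨A₁, hA₁, hfr⟩ := hω.exists_frequently hJ fun m i => v (e m i)
  refine ⟨A₀ ∪ A₁, hJ.union_mem _ _ hA₀ hA₁, ?_⟩
  rw [notMem_immovableIdeal]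
  intro m
  obtain ⟨n, hmn, hn⟩ := frequently_atTop.1 hfr m
  obtain ⟨φ, hφ, hφA⟩ := extraction_of_frequently_atTop hn
  refine ⟨e n ∘ φ, fun i => ?_, ((he n).anti (hF hmn)).comp hφ.tendsto_atTop⟩
  rcases hv _ (heY n (φ i)) with h | h
  · exact closure_mono (inter_subset_inter_right _ (preimage_mono subset_union_left)) h
  · refine closure_mono (inter_subset_inter_right _ (preimage_mono ?_)) h
    rw [singleton_subset_iff]
    exact Or.inr (hφA i)

theorem image_mem_immovableIdeal {F : ℕ → Set G} {A : Set G} (hA : A ∈ immovableIdeal F)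
    (φ : G ≃ₜ G) (hF : ∀ n, ∃ n', ∀ x ∈ F n, φ x ∈ F n')
    (hV : ∀ V ∈ 𝓝 (1 : G), ∃ V' ∈ 𝓝 (1 : G), ∀ r ∈ V', ∀ w ∈ V', ∃ r' ∈ V, ∃ w' ∈ V,
      ∀ x, φ (r' * x * w') = r * φ x * w) : φ '' A ∈ immovableIdeal F := by
  obtain ⟨m, hm⟩ := hA
  obtain ⟨n, hn⟩ := hF m
  refine ⟨n, fun e he hmov => hm (φ.symm ∘ e) (fun i => ?_) ?_⟩
  · rw [← φ.image_closure] at he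
    obtain ⟨y, hy, hye⟩ := he i
    rwa [Function.comp_apply, ← hye, φ.symm_apply_apply]
  · refine IsMovable.of_comp φ.continuous hn hV ?_
    convert hmov
    ext i
    simp

variable [IsTopologicalGroup G]

theorem IsMovable.frequently_notMem {F : Set G} {e : ℕ → G} (h : IsMovable F e) {a : G}
    (ha : ∃ᶠ i in atTop, e i = a) : a ∉ F := by
  obtain ⟨Z, h1, h2, h3⟩ := h
  refine h2.notMem_of_mem_left (?_ : a ∈ Z)
  rw [← h1.closure_eq, mem_closure_iff_nhds]
  intro U hU
  have hc : Tendsto (fun p : G × G => p.1 * a * p.2) (𝓝 1 ×ˢ 𝓝 1) (𝓝 a) := by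
    have : Continuous fun p : G × G => p.1 * a * p.2 := by fun_prop
    simpa [nhds_prod_eq] using this.tendsto (1, 1)
  obtain ⟨V, hV, hVU⟩ := (mem_prod_self_iff).1 (hc hU)
  obtain ⟨r, hr, w, hw, hrw⟩ := h3 V hV
  obtain ⟨i, hi, hi'⟩ := (ha.and_eventually hrw).exists
  rw [hi] at hi'
  exact ⟨r * a * w, hVU (mk_mem_prod hr hw), hi'⟩

theorem isSetIdeal_immovableIdeal [T1Space G] {F : ℕ → Set G} (hF : IsCapturingScale F) :
    IsSetIdeal (immovableIdeal F) := by
  refine ⟨fun A hA => ?_, ?_, ?_⟩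
  · have : ∃ m, A ⊆ F m := by
      refine hA.induction_on A ⟨0, empty_subset _⟩ ?_
      rintro a s - - ⟨m, hm⟩
      obtain ⟨n, hn⟩ := hF.covering a
      refine ⟨max n m, insert_subset (hF.mono (le_max_left _ _) hn) ?_⟩
      exact hm.trans (hF.mono (le_max_right _ _))
    obtain ⟨m, hm⟩ := this
    refine ⟨m, fun e he hmov => ?_⟩
    rw [hA.isClosed.closure_eq] at he
    have : ∃ a ∈ A, ∃ᶠ i in atTop, e i = a := by
      by_contra! hcon
      have : ∀ᶠ i in atTop, ∀ a ∈ A, e i ≠ a := by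
        rw [eventually_all_finite hA]
        exact hcon
      obtain ⟨i, hi⟩ := this.exists
      exact hi _ (he i) rfl
    obtain ⟨a, ha, hfr⟩ := this
    exact hmov.frequently_notMem hfr (hm ha)
  · rintro A B ⟨m, hm⟩ hB
    exact ⟨m, fun e he => hm e fun i => closure_mono hB (he i)⟩
  · rintro A B ⟨m, hm⟩ ⟨n, hn⟩
    refine ⟨max m n, fun e he hmov => ?_⟩
    rw [closure_union] at he
    obtain ⟨φ, hφ⟩ := Nat.exists_subseq_of_forall_mem_union e he
    rcases hφ with h | h
    · exact hm _ h ((hmov.anti (hF.mono (le_max_left _ _))).comp φ.strictMono.tendsto_atTop)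
    · exact hn _ h ((hmov.anti (hF.mono (le_max_right _ _))).comp φ.strictMono.tendsto_atTop)

theorem isInvariantFamily_immovableIdeal {F : ℕ → Set G} (hF : IsCapturingScale F) :
    IsInvariantFamily (immovableIdeal F) := by
  refine ⟨fun g A hA => ?_, fun g A hA => ?_, fun A hA => ?_⟩
  · refine image_mem_immovableIdeal hA (Homeomorph.mulLeft g) (fun n => ?_) fun V hV => ?_
    · obtain ⟨n', h⟩ := hF.translate g 1 n
      exact ⟨n', fun x hx => by simpa using h x hx⟩
    · have hc : Tendsto (fun r : G => g⁻¹ * r * g) (𝓝 1) (𝓝 1) := by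
        have : Continuous fun r : G => g⁻¹ * r * g := by fun_prop
        simpa using this.tendsto 1
      refine ⟨_, inter_mem hV (hc hV), fun r hr w hw => ⟨_, hr.2, w, hw.1, fun x => ?_⟩⟩
      simp [mul_assoc]
  · refine image_mem_immovableIdeal hA (Homeomorph.mulRight g) (fun n => ?_) fun V hV => ?_
    · obtain ⟨n', h⟩ := hF.translate 1 g n
      exact ⟨n', fun x hx => by simpa using h x hx⟩
    · have hc : Tendsto (fun r : G => g * r * g⁻¹) (𝓝 1) (𝓝 1) := by
        have : Continuous fun r : G => g * r * g⁻¹ := by fun_prop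
        simpa using this.tendsto 1
      refine ⟨_, inter_mem hV (hc hV), fun r hr w hw => ⟨r, hr.1, _, hw.2, fun x => ?_⟩⟩
      simp [mul_assoc]
  · refine image_mem_immovableIdeal hA (Homeomorph.inv G) (fun n => ?_) fun V hV => ?_
    · obtain ⟨n', h⟩ := hF.inv n
      exact ⟨n', fun x hx => by simpa using h x hx⟩
    · refine ⟨V⁻¹, inv_mem_nhds_one G hV, fun r hr w hw => ⟨w⁻¹, hw, r⁻¹, hr, fun x => ?_⟩⟩
      simp [mul_assoc]

theorem exists_isOpen_closure_mul_mul_subset {U : Set G} (hU : U ∈ 𝓝 (1 : G)) :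
    ∃ V : Set G, IsOpen V ∧ (1 : G) ∈ V ∧
      ∀ x ∈ closure V, ∀ y ∈ closure V, ∀ z ∈ closure V, x * y * z ∈ U := by
  have hc : Tendsto (fun p : G × G × G => p.1 * p.2.1 * p.2.2) (𝓝 1 ×ˢ 𝓝 1 ×ˢ 𝓝 1) (𝓝 1) := by
    have : Continuous fun p : G × G × G => p.1 * p.2.1 * p.2.2 := by fun_prop
    simpa [nhds_prod_eq] using this.tendsto (1, 1, 1)
  obtain ⟨W₁, hW₁, W₂, hW₂, h₁⟩ := mem_prod_iff.1 (hc hU)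
  obtain ⟨W₃, hW₃, W₄, hW₄, h₂⟩ := mem_prod_iff.1 hW₂
  obtain ⟨K, hK, hKc, hKW⟩ := exists_mem_nhds_isClosed_subset (inter_mem hW₁ (inter_mem hW₃ hW₄))
  refine ⟨interior K, isOpen_interior, mem_interior_iff_mem_nhds.2 hK, ?_⟩
  have : closure (interior K) ⊆ _ := (closure_minimal interior_subset hKc).trans hKW
  intro x hx y hy z hz
  exact h₁ (mk_mem_prod (this hx).1 (h₂ (mk_mem_prod (this hy).2.1 (this hz).2.2)))

/-- The sets `Z l m` with `l ≤ m` and `m₀ ≤ m` have a closed union `T` missing 1: convergent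
sequences are captured by some `F k`, which meets only the finitely many `Z l m` with `m < k`. If
products of three elements of `closure V` avoid `T`, the sequences `e l m` eventually leave `closure
V` and so witness that `h l \ V` is positive. -/
theorem not_hasAlmostPiNetwork_immovableIdeal [T1Space G] [SequentialSpace G]
    {F : ℕ → Set G} (hF : IsCapturingScale F) : ¬ HasAlmostPiNetwork (immovableIdeal F) := by
  rintro ⟨H, hH, hpos, hnet⟩
  have hHne : H.Nonempty := by
    obtain ⟨A, hA, -⟩ := hnet univ isOpen_univ univ_nonempty
    exact ⟨A, hA⟩
  obtain ⟨h, rfl⟩ := hH.exists_eq_range hHne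
  have hpos' : ∀ l m, ∃ e : ℕ → G, (∀ i, e i ∈ closure (h l)) ∧ IsMovable (F m) e := fun l =>
    notMem_immovableIdeal.1 (hpos _ (mem_range_self l))
  choose e he hmov using hpos'
  choose Z hZc hZF hZ using hmov
  obtain ⟨m₀, hm₀⟩ := hF.covering 1
  set T : Set G := {x | ∃ l m, l ≤ m ∧ m₀ ≤ m ∧ x ∈ Z l m} with hT
  have hTc : IsClosed T := by
    refine isClosed_of_seqConvergesTo fun C x hCT hC => ?_
    obtain ⟨k, hk⟩ := hF.capturing C x hC
    have hsub : C ∩ F k ⊆ ⋃ p ∈ {p : ℕ × ℕ | p.1 ≤ p.2 ∧ m₀ ≤ p.2 ∧ p.2 < k}, C ∩ Z p.1 p.2 := by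
      rintro y ⟨hy, hyk⟩
      obtain ⟨l, m, hlm, hm, hyZ⟩ := hCT hy
      simp only [mem_iUnion]
      refine ⟨(l, m), ⟨hlm, hm, ?_⟩, hy, hyZ⟩
      by_contra hkm
      exact (hZF l m).notMem_of_mem_left hyZ (hF.mono (not_lt.1 hkm) hyk)
    have hfin : {p : ℕ × ℕ | p.1 ≤ p.2 ∧ m₀ ≤ p.2 ∧ p.2 < k}.Finite := by
      refine ((finite_Iio k).prod (finite_Iio k)).subset ?_
      rintro ⟨l, m⟩ ⟨h1, -, h2⟩
      exact ⟨lt_of_le_of_lt h1 h2, h2⟩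
    have : ∃ p : ℕ × ℕ, (p.1 ≤ p.2 ∧ m₀ ≤ p.2 ∧ p.2 < k) ∧ (C ∩ Z p.1 p.2).Infinite := by
      by_contra! hcon
      exact hk ((hfin.biUnion fun p hp => hcon p hp).subset hsub)
    obtain ⟨⟨l, m⟩, ⟨h1, h2, -⟩, h3⟩ := this
    refine ⟨l, m, h1, h2, ?_⟩
    rw [← (hZc l m).closure_eq]
    exact hC.mem_closure h3
  have h1T : (1 : G) ∉ T := by
    rintro ⟨l, m, -, hm, hZ1⟩
    exact (hZF l m).notMem_of_mem_left hZ1 (hF.mono hm hm₀)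
  obtain ⟨V, hVo, h1V, hVU⟩ :=
    exists_isOpen_closure_mul_mul_subset (hTc.isOpen_compl.mem_nhds h1T)
  obtain ⟨_, ⟨l, rfl⟩, n, hn⟩ := hnet V hVo ⟨1, h1V⟩
  -- The bounds `l` and `m₀` place `Z l m` inside `T`; the bound `n` contradicts immovability off `F
  -- n`.
  set m := max (max l m₀) n with hm
  obtain ⟨r, hr, w, hw, hrw⟩ := hZ l m V (hVo.mem_nhds h1V)
  obtain ⟨N, hN⟩ := eventually_atTop.1 hrw
  refine hn (fun i => e l m (i + N)) (fun i => ?_) ?_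
  · have hV' : e l m (i + N) ∉ closure V := fun hcl =>
      hVU r (subset_closure hr) _ hcl w (subset_closure hw)
        ⟨l, m, (le_max_left _ _).trans (le_max_left _ _), (le_max_right _ _).trans (le_max_left _ _),
          hN _ (Nat.le_add_left _ _)⟩
    have : e l m (i + N) ∈ closure (h l \ V ∪ V) :=
      closure_mono (by rw [sdiff_union_self]; exact subset_union_left) (he l m _)
    rw [closure_union] at this
    exact this.resolve_right hV'
  · exact (IsMovable.anti ⟨Z l m, hZc l m, hZF l m, hZ l m⟩ (hF.mono (le_max_right _ _))).comp
      (tendsto_add_atTop_nat N)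

end Scale

theorem hasSeqCapturing_immovableIdeal (hIIA : InvariantIdealAxiom) {G : Type} [Group G]
    [TopologicalSpace G] [IsTopologicalGroup G] [T1Space G] [Countable G] [SequentialSpace G]
    (hd : ¬ DiscreteTopology G) {F : ℕ → Set G} (hF : IsCapturingScale F) :
    HasSeqCapturing (immovableIdeal F) :=
  (hIIA G (isGroomed_of_sequentialSpace hd) _ (isSetIdeal_immovableIdeal hF)
    (isTame_immovableIdeal hF.mono)
    (isWeaklyClosed_of_closure_mem (isSetIdeal_immovableIdeal hF)
      fun _ => closure_mem_immovableIdeal)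
    (isInvariantFamily_immovableIdeal hF)).resolve_right
    (not_hasAlmostPiNetwork_immovableIdeal hF)

/-! ### Escaping sequences and compactness. -/

/-- A sequence without cluster points. -/
def IsEscaping {X : Type*} [TopologicalSpace X] (e : ℕ → X) : Prop :=
  ∀ x, ∃ W ∈ 𝓝 x, ∀ᶠ i in atTop, e i ∉ W

section Escaping

variable {X : Type*} [TopologicalSpace X]

theorem IsEscaping.comp {e : ℕ → X} (he : IsEscaping e) {φ : ℕ → ℕ}
    (hφ : Tendsto φ atTop atTop) : IsEscaping (e ∘ φ) := by
  intro x
  obtain ⟨W, hW, h⟩ := he x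
  exact ⟨W, hW, hφ.eventually h⟩

theorem IsEscaping.not_tendsto {e : ℕ → X} (he : IsEscaping e) (x : X) :
    ¬ Tendsto e atTop (𝓝 x) := by
  intro h
  obtain ⟨W, hW, hW'⟩ := he x
  obtain ⟨i, hi, hi'⟩ := (hW'.and (h.eventually_mem hW)).exists
  exact hi hi'

theorem exists_subseq_tendsto_of_not_isEscaping [SequentialSpace X] [T1Space X] {e : ℕ → X}
    (he : ¬ IsEscaping e) : ∃ (φ : ℕ → ℕ) (x : X), StrictMono φ ∧ Tendsto (e ∘ φ) atTop (𝓝 x) := by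
  simp only [IsEscaping, not_forall, not_exists, not_and] at he
  obtain ⟨x, hx⟩ := he
  by_cases hfr : ∃ᶠ i in atTop, e i = x
  · obtain ⟨φ, hφ, h⟩ := extraction_of_frequently_atTop hfr
    refine ⟨φ, x, hφ, ?_⟩
    rw [show e ∘ φ = fun _ => x from funext h]
    exact tendsto_const_nhds
  rw [not_frequently, eventually_atTop] at hfr
  obtain ⟨N, hN⟩ := hfr
  have hnc : ¬ IsClosed (e '' Ici N) := by
    intro hc
    refine hx _ (hc.isOpen_compl.mem_nhds ?_) (eventually_atTop.2 ⟨N, fun i hi h => ?_⟩)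
    · rintro ⟨i, hi, hix⟩
      exact hN i hi hix
    · exact h ⟨i, hi, rfl⟩
  have : ∃ (C : Set X) (y : X), C ⊆ e '' Ici N ∧ SeqConvergesTo C y := by
    by_contra! hcon
    exact hnc (isClosed_of_seqConvergesTo fun C y h1 h2 => absurd h2 (hcon C y h1))
  obtain ⟨C, y, hC, hCy⟩ := this
  obtain ⟨u, hu, rfl, huy⟩ := hCy.exists_seq
  have hn : ∀ k, ∃ n, e n = u k := fun k => by
    obtain ⟨n, -, hn⟩ := hC (mem_range_self k)
    exact ⟨n, hn⟩
  choose n hn using hn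
  have hninj : Function.Injective n := fun i j hij => hu (by rw [← hn, ← hn, hij])
  obtain ⟨φ, hφ, hφn⟩ := strictMono_subseq_of_tendsto_atTop hninj.nat_tendsto_atTop
  refine ⟨n ∘ φ, y, hφn, ?_⟩
  rw [show e ∘ n ∘ φ = u ∘ φ from funext fun k => hn (φ k)]
  exact huy.comp hφ.tendsto_atTop

/-- A closed countable set in which no sequence escapes is compact. -/
theorem isCompact_of_forall_not_isEscaping {K : Set X} (hK : IsClosed K) (hc : K.Countable)
    (h : ∀ e : ℕ → X, (∀ i, e i ∈ K) → ¬ IsEscaping e) : IsCompact K := by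
  have hcc : IsCountablyCompact K := by
    refine IsCountablyCompact.of_seq_clusterPt fun e he => ?_
    obtain ⟨N, hN⟩ := eventually_atTop.1 he
    have := h (fun i => e (i + N)) fun i => hN _ (Nat.le_add_left _ _)
    simp only [IsEscaping, not_forall, not_exists, not_and] at this
    obtain ⟨x, hx⟩ := this
    have hfr : ∀ W ∈ 𝓝 x, ∃ᶠ i in atTop, e i ∈ W := fun W hW => by
      have h1 : ∃ᶠ i in atTop, e (i + N) ∈ W := by simpa [Filter.Frequently] using hx W hW
      exact (tendsto_add_atTop_nat N).frequently h1
    refine ⟨x, ?_, mapClusterPt_iff_frequently.2 hfr⟩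
    rw [← hK.closure_eq, mem_closure_iff_nhds]
    intro W hW
    obtain ⟨i, hi, hi'⟩ := ((hfr W hW).and_eventually he).exists
    exact ⟨e i, hi, hi'⟩
  -- Countability of `K` reduces any open cover to a countable one.
  refine isCompact_of_finite_subcover fun {ι} U hU hKU => ?_
  classical
  have hex : ∀ x : K, ∃ i, (x : X) ∈ U i := fun x => mem_iUnion.1 (hKU x.2)
  choose i hi using hex
  have := hc.to_subtype
  obtain ⟨t, ht⟩ := hcc.elim_finite_subcover (fun x : K => hU (i x))
    fun x hx => mem_iUnion.2 ⟨⟨x, hx⟩, hi ⟨x, hx⟩⟩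
  refine ⟨t.image i, fun x hx => ?_⟩
  obtain ⟨k, hk, hxk⟩ := mem_iUnion₂.1 (ht hx)
  exact mem_iUnion₂.2 ⟨i k, Finset.mem_image_of_mem i hk, hxk⟩

theorem exists_seqClosure_of_not_frechetUrysohnSpace [SequentialSpace X]
    (hnF : ¬ FrechetUrysohnSpace X) :
    ∃ (A : Set X) (x : ℕ → X) (y : X), (∀ i, x i ∈ seqClosure A) ∧ y ∉ seqClosure A ∧
      Tendsto x atTop (𝓝 y) := by
  by_contra! hcon
  refine hnF ⟨fun A => closure_minimal subset_seqClosure ?_⟩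
  refine IsSeqClosed.isClosed fun x y hx hxy => ?_
  by_contra hy
  exact hcon A x y hx hy hxy

/-- Either a matrix of points has an escaping crossing sequence, or, after thinning out, its rows
converge to a point. -/
theorem exists_crossing_isEscaping_or [Countable X] [Nonempty X] (E : ℕ → ℕ → X) :
    (∃ φ a : ℕ → ℕ, StrictMono φ ∧ IsEscaping fun s => E (φ s) (a s)) ∨
    ∃ (φ : ℕ → ℕ) (ψ : ℕ → ℕ → ℕ) (g : X), StrictMono φ ∧ (∀ s, StrictMono (ψ s)) ∧
      ∀ U ∈ 𝓝 g, ∀ᶠ s in atTop, ∀ᶠ b in atTop, E (φ s) (ψ s b) ∈ U := by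
  by_cases hcase : ∀ P : ℕ → ℕ → Prop, (∃ᶠ i in atTop, ∃ᶠ a in atTop, P i a) → ∀ g : X,
      ∃ U ∈ 𝓝 g, ∃ᶠ i in atTop, ∃ᶠ a in atTop, P i a ∧ E i a ∉ U
  · left
    obtain ⟨g, hg⟩ := exists_surjective_nat X
    choose U hU hPU using hcase
    -- Stage `k + 1` discards the entries near the `k`-th point, still leaving infinitely many
    -- entries in infinitely many rows; a diagonal through the stages escapes.
    let Q : ℕ → {P : ℕ → ℕ → Prop // ∃ᶠ i in atTop, ∃ᶠ a in atTop, P i a} := fun n =>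
      Nat.rec ⟨fun _ _ => True, (Eventually.of_forall fun _ =>
        (Eventually.of_forall fun _ => trivial).frequently).frequently⟩
        (fun k P => ⟨fun i a => P.1 i a ∧ E i a ∉ U P.1 P.2 (g k), hPU P.1 P.2 (g k)⟩) n
    have hQ : ∀ k i a, (Q (k + 1)).1 i a →
        (Q k).1 i a ∧ E i a ∉ U (Q k).1 (Q k).2 (g k) := fun k i a h => h
    have hanti : ∀ k l, k ≤ l → ∀ i a, (Q l).1 i a → (Q k).1 i a := by
      intro k l hkl
      induction hkl with
      | refl => exact fun i a h => h
      | step _ ih => exact fun i a h => ih i a (hQ _ i a h).1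
    obtain ⟨φ, hφ, hφQ⟩ := extraction_forall_of_frequently
      (P := fun n i => ∃ a, (Q n).1 i a) fun n => (Q n).2.mono fun i hi => hi.exists
    choose a ha using hφQ
    refine ⟨φ, a, hφ, fun x => ?_⟩
    obtain ⟨k, rfl⟩ := hg x
    refine ⟨_, hU (Q k).1 (Q k).2 (g k), eventually_atTop.2 ⟨k + 1, fun s hs => ?_⟩⟩
    exact (hQ k _ _ (hanti (k + 1) s hs _ _ (ha s))).2
  · right
    push Not at hcase
    obtain ⟨P, hP, g, hg⟩ := hcase
    obtain ⟨φ, hφ, hφP⟩ := extraction_of_frequently_atTop hP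
    have hψ : ∀ s, ∃ ψ : ℕ → ℕ, StrictMono ψ ∧ ∀ b, P (φ s) (ψ b) := fun s =>
      extraction_of_frequently_atTop (hφP s)
    choose ψ hψ hψP using hψ
    refine ⟨φ, ψ, g, hφ, hψ, fun U hU => ?_⟩
    filter_upwards [hφ.tendsto_atTop.eventually (hg U hU)] with s hs
    filter_upwards [(hψ s).tendsto_atTop.eventually hs] with b hb
    exact hb (hψP s b)

/-- Sets meeting a neighbourhood of each point in a finite set. -/
def IsLocallyFiniteSet (Z : Set X) : Prop :=
  ∀ x, ∃ W ∈ 𝓝 x, (W ∩ Z).Finite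

theorem IsLocallyFiniteSet.isClosed [T1Space X] {Z : Set X}
    (hZ : IsLocallyFiniteSet Z) : IsClosed Z := by
  rw [← isOpen_compl_iff, isOpen_iff_mem_nhds]
  intro x hx
  obtain ⟨W, hW, hfin⟩ := hZ x
  filter_upwards [hW, hfin.isClosed.isOpen_compl.mem_nhds fun h => hx h.2] with y hy hy' hyZ
  exact hy' ⟨hy, hyZ⟩

end Escaping

/-! ### Groups that are not Fréchet. -/

section NonFrechet

variable {G : Type*} [Group G] [TopologicalSpace G] [IsTopologicalGroup G] [T1Space G]
  [Countable G] [SequentialSpace G]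

/-- A sequential group that is not Fréchet contains a convergent sequence of convergent sequences
such that no sequence crossing infinitely many of them converges. -/
theorem exists_fan_of_not_frechetUrysohnSpace (hnF : ¬ FrechetUrysohnSpace G) :
    ∃ (x : ℕ → G) (c : ℕ → ℕ → G), Tendsto x atTop (𝓝 1) ∧ (∀ i, Tendsto (c i) atTop (𝓝 (x i))) ∧
      ∀ (φ a : ℕ → ℕ) (y : G), StrictMono φ → ¬ Tendsto (fun s => c (φ s) (a s)) atTop (𝓝 y) := by
  obtain ⟨A, x, p, hxA, hpA, hx⟩ := exists_seqClosure_of_not_frechetUrysohnSpace hnF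
  choose c hcA hcx using hxA
  -- A crossing sequence cannot converge to `p`, which is outside `seqClosure A`. Other limits are
  -- excluded by cutting off the start of row `i`, so that it avoids those `W (g k)`, `k ≤ i`, whose
  -- closure misses `x i`.
  have hW : ∀ g : G, ∃ W ∈ 𝓝 g, g ≠ p → p ∉ closure W := by
    intro g
    by_cases hg : g = p
    · exact ⟨univ, univ_mem, fun h => absurd hg h⟩
    · obtain ⟨K, hK, hKc, hKp⟩ := exists_mem_nhds_isClosed_subset
        (isOpen_compl_singleton.mem_nhds hg : ({p}ᶜ : Set G) ∈ 𝓝 g)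
      refine ⟨K, hK, fun _ hp => ?_⟩
      rw [hKc.closure_eq] at hp
      exact hKp hp rfl
  choose W hWg hWp using hW
  obtain ⟨g, hg⟩ := exists_surjective_nat G
  have hN : ∀ i, ∃ N, ∀ a ≥ N, ∀ k ∈ Iic i, x i ∉ closure (W (g k)) → c i a ∉ W (g k) := by
    intro i
    rw [← eventually_atTop, eventually_all_finite (finite_Iic i)]
    intro k _
    by_cases hk : x i ∈ closure (W (g k))
    · exact Eventually.of_forall fun a h => absurd hk h
    · filter_upwards [(hcx i).eventually_mem (isClosed_closure.isOpen_compl.mem_nhds hk)] with a ha _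
      exact fun h => ha (subset_closure h)
  choose N hN using hN
  refine ⟨fun i => p⁻¹ * x i, fun i a => p⁻¹ * c i (a + N i), ?_, fun i => ?_, ?_⟩
  · simpa using hx.const_mul p⁻¹
  · exact ((hcx i).comp (tendsto_add_atTop_nat (N i))).const_mul p⁻¹
  · intro φ a y hφ hy
    have hy' : Tendsto (fun s => c (φ s) (a s + N (φ s))) atTop (𝓝 (p * y)) := by
      simpa using hy.const_mul p
    by_cases hpy : p * y = p
    · rw [hpy] at hy'
      exact hpA ⟨_, fun s => hcA _ _, hy'⟩
    · obtain ⟨k, hk⟩ := hg (p * y)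
      have h1 := hy'.eventually_mem (hWg (p * y))
      have h2 := (hx.comp hφ.tendsto_atTop).eventually_mem
        (isClosed_closure.isOpen_compl.mem_nhds (hWp (p * y) hpy))
      obtain ⟨s, ⟨hs1, hs2⟩, hs3⟩ :=
        ((h1.and h2).and (hφ.tendsto_atTop.eventually_ge_atTop k)).exists
      rw [← hk] at hs1 hs2
      exact hN (φ s) _ (Nat.le_add_left _ _) k hs3 hs2 hs1

/-- In a group that is not Fréchet, every sequence of escaping sequences is crossed by an escaping
sequence. -/
theorem exists_crossing_isEscaping (hnF : ¬ FrechetUrysohnSpace G) {E : ℕ → ℕ → G}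
    (hE : ∀ i, IsEscaping (E i)) :
    ∃ φ a : ℕ → ℕ, StrictMono φ ∧ IsEscaping fun s => E (φ s) (a s) := by
  by_contra hNX
  obtain ⟨φ, ψ, g, hφ, hψ, hg⟩ := (exists_crossing_isEscaping_or E).resolve_left hNX
  obtain ⟨x, c, hx, hc, hcross⟩ := exists_fan_of_not_frechetUrysohnSpace hnF
  set d : ℕ → ℕ → G := fun i b => E (φ i) (ψ i b) with hd
  have hdesc : ∀ i, IsEscaping (d i) := fun i => (hE (φ i)).comp (hψ i).tendsto_atTop
  have hdX : ∀ θ a : ℕ → ℕ, StrictMono θ → ¬ IsEscaping fun s => d (θ s) (a s) :=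
    fun θ a hθ h => hNX ⟨φ ∘ θ, fun s => ψ (θ s) (a s), hφ.comp hθ, h⟩
  set Z : Set G := {z | z ≠ g ∧ ∃ i a, c i a * d i a = z} with hZ
  -- the products of a fixed row do not converge along any subsequence
  have hrow : ∀ (i : ℕ) (θ : ℕ → ℕ) (y : G), Tendsto θ atTop atTop →
      ¬ Tendsto (fun t => c i (θ t) * d i (θ t)) atTop (𝓝 y) := by
    intro i θ y hθ h
    refine ((hdesc i).comp hθ).not_tendsto ((x i)⁻¹ * y) ?_
    have := (((hc i).comp hθ).inv).mul h
    simpa [Function.comp_def] using this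
  have hgZ : g ∈ closure Z := by
    rw [mem_closure_iff_nhds]
    intro O hO
    have hmul : Tendsto (fun p : G × G => p.1 * p.2) (𝓝 1 ×ˢ 𝓝 g) (𝓝 g) := by
      have : Continuous fun p : G × G => p.1 * p.2 := by fun_prop
      simpa [nhds_prod_eq] using this.tendsto (1, g)
    obtain ⟨U₁, hU₁, U₂, hU₂, hUO⟩ := mem_prod_iff.1 (hmul hO)
    obtain ⟨i, hi₁, hi₂⟩ := ((hx.eventually (eventually_mem_nhds_iff.2 hU₁)).and (hg U₂ hU₂)).exists
    have hne : ∀ᶠ a in atTop, c i a * d i a ≠ g := by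
      by_contra hcon
      obtain ⟨θ, hθ, hθg⟩ := extraction_of_frequently_atTop hcon
      refine hrow i θ g hθ.tendsto_atTop (tendsto_const_nhds.congr fun t => ?_)
      exact (hθg t).symm
    obtain ⟨a, ⟨ha₁, ha₂⟩, ha₃⟩ := (((hc i).eventually_mem hi₁).and hi₂ |>.and hne).exists
    exact ⟨c i a * d i a, hUO (mk_mem_prod ha₁ ha₂), ha₃, i, a, rfl⟩
  have : ∃ (C : Set G) (y : G), C ⊆ Z ∧ SeqConvergesTo C y := by
    by_contra! hcon
    have hcl : IsClosed Z := isClosed_of_seqConvergesTo fun C y h1 h2 => absurd h2 (hcon C y h1)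
    rw [hcl.closure_eq] at hgZ
    exact hgZ.1 rfl
  obtain ⟨C, y, hCZ, hCy⟩ := this
  obtain ⟨u, hu, rfl, huy⟩ := hCy.exists_seq
  have hex : ∀ t, ∃ i a, c i a * d i a = u t := fun t => (hCZ (mem_range_self t)).2
  choose i a hia using hex
  by_cases hconst : ∃ k, ∃ᶠ t in atTop, i t = k
  · obtain ⟨k, hk⟩ := hconst
    obtain ⟨θ, hθ, hθk⟩ := extraction_of_frequently_atTop hk
    have hinj : Function.Injective (a ∘ θ) := fun s t hst => hθ.injective (hu (by
      rw [← hia, ← hia, hθk, hθk]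
      simp only [Function.comp_apply] at hst
      rw [hst]))
    refine hrow k (a ∘ θ) y hinj.nat_tendsto_atTop ((huy.comp hθ.tendsto_atTop).congr fun t => ?_)
    rw [Function.comp_apply, ← hia, hθk]
    rfl
  · push Not at hconst
    have hi : Tendsto i atTop atTop := by
      rw [tendsto_atTop]
      intro b
      have : ∀ᶠ t in atTop, ∀ k ∈ Iio b, i t ≠ k := by
        rw [eventually_all_finite (finite_Iio b)]
        exact fun k _ => hconst k
      filter_upwards [this] with t ht
      by_contra hlt
      exact ht (i t) (not_le.1 hlt) rfl
    obtain ⟨θ, hθ, hθi⟩ := strictMono_subseq_of_tendsto_atTop hi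
    obtain ⟨ρ, z, hρ, hz⟩ :=
      exists_subseq_tendsto_of_not_isEscaping (hdX (i ∘ θ) (a ∘ θ) hθi)
    refine hcross (i ∘ θ ∘ ρ) (a ∘ θ ∘ ρ) (y * z⁻¹) (hθi.comp hρ) ?_
    refine ((huy.comp (hθ.comp hρ).tendsto_atTop).mul hz.inv).congr fun t => ?_
    simp [← hia]

/-- An escaping sequence that can be moved off `F` pointwise near the identity is movable. -/
theorem IsEscaping.isMovable {e : ℕ → G} (he : IsEscaping e) {F R : Set G}
    (hR : (1 : G) ∈ closure R) (hRF : ∀ r ∈ R, ∀ᶠ i in atTop, r * e i ∉ F) : IsMovable F e := by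
  -- It contains `R` and is sequentially closed, hence contains 1.
  set P : Set G := {σ | ∃ Z : Set G, IsLocallyFiniteSet Z ∧ Disjoint Z F ∧
    ∀ V ∈ 𝓝 σ, ∃ r ∈ V, ∀ᶠ i in atTop, r * e i ∈ Z} with hP
  have hRP : R ⊆ P := by
    intro r hr
    obtain ⟨N, hN⟩ := eventually_atTop.1 (hRF r hr)
    refine ⟨(fun i => r * e i) '' Ici N, fun x => ?_, ?_, fun V hV => ⟨r, mem_of_mem_nhds hV, ?_⟩⟩
    · obtain ⟨W, hW, hWe⟩ := he (r⁻¹ * x)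
      obtain ⟨M, hM⟩ := eventually_atTop.1 hWe
      refine ⟨(fun y => r⁻¹ * y) ⁻¹' W, (continuous_const_mul _).continuousAt.preimage_mem_nhds hW,
        ((finite_Iio M).image fun i => r * e i).subset ?_⟩
      rintro _ ⟨hy, i, -, rfl⟩
      refine ⟨i, ?_, rfl⟩
      by_contra hi
      exact hM i (not_lt.1 hi) (by simpa using hy)
    · rw [disjoint_left]
      rintro _ ⟨i, hi, rfl⟩
      exact hN i hi
    · exact eventually_atTop.2 ⟨N, fun i hi => ⟨i, hi, rfl⟩⟩
  have hPc : IsClosed P := by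
    refine IsSeqClosed.isClosed fun σ τ hσ hτ => ?_
    choose Z hZf hZF hZ using hσ
    obtain ⟨p, hp⟩ := exists_surjective_nat G
    have hex : ∀ k, ∃ V W : Set G, IsOpen V ∧ τ ∈ V ∧ W ∈ 𝓝 (p k) ∧
        ∀ r ∈ V, ∀ᶠ i in atTop, r * e i ∉ W := by
      intro k
      obtain ⟨O, hO, hOe⟩ := he (τ⁻¹ * p k)
      have hc : Tendsto (fun q : G × G => q.1⁻¹ * q.2) (𝓝 τ ×ˢ 𝓝 (p k)) (𝓝 (τ⁻¹ * p k)) := by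
        have : Continuous fun q : G × G => q.1⁻¹ * q.2 := by fun_prop
        simpa [nhds_prod_eq] using this.tendsto (τ, p k)
      obtain ⟨V, hV, W, hW, hVW⟩ := mem_prod_iff.1 (hc hO)
      obtain ⟨V', hV'V, hV'o, hτ'⟩ := mem_nhds_iff.1 hV
      refine ⟨V', W, hV'o, hτ', hW, fun r hr => hOe.mono fun i hi hw => hi ?_⟩
      simpa using hVW (mk_mem_prod (hV'V hr) hw)
    choose V W hVo hτV hW hVW using hex
    -- Removing the `W k` leaves only finitely many pieces near each `p k`. The condition `σ b ∈ V
    -- k` makes the removal harmless: translates of `e` by elements of `V k` eventually leave `W k`.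
    set Z' : ℕ → Set G := fun b => {z | z ∈ Z b ∧ ∀ k ≤ b, σ b ∈ V k → z ∉ W k} with hZ'
    refine ⟨⋃ b, Z' b, fun x => ?_, ?_, fun U hU => ?_⟩
    · obtain ⟨k, rfl⟩ := hp x
      obtain ⟨B, hB⟩ := eventually_atTop.1
        ((hτ.eventually_mem ((hVo k).mem_nhds (hτV k))).and (eventually_ge_atTop k))
      choose T hT hTfin using fun b => hZf b (p k)
      refine ⟨W k ∩ ⋂ b ∈ Iio B, T b,
        inter_mem (hW k) ((biInter_mem (finite_Iio B)).2 fun b _ => hT b),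
        ((finite_Iio B).biUnion fun b _ => hTfin b).subset ?_⟩
      rintro z ⟨⟨hzW, hzT⟩, hzZ⟩
      obtain ⟨b, hzb, hzb'⟩ := mem_iUnion.1 hzZ
      have hbB : b < B := by
        by_contra hle
        obtain ⟨h1, h2⟩ := hB b (not_lt.1 hle)
        exact hzb' k h2 h1 hzW
      exact mem_iUnion₂.2 ⟨b, hbB, mem_iInter₂.1 hzT b hbB, hzb⟩
    · rw [disjoint_iUnion_left]
      exact fun b => (hZF b).mono_left fun z hz => hz.1
    · obtain ⟨b, hb⟩ := (hτ.eventually (eventually_mem_nhds_iff.2 hU)).exists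
      have hmem : (U ∩ ⋂ k ∈ {k | k ≤ b ∧ σ b ∈ V k}, V k) ∈ 𝓝 (σ b) :=
        inter_mem hb ((biInter_mem ((finite_Iic b).subset fun k hk => hk.1)).2
          fun k hk => (hVo k).mem_nhds hk.2)
      obtain ⟨r, ⟨hrU, hrV⟩, hr⟩ := hZ b _ hmem
      refine ⟨r, hrU, ?_⟩
      have hev : ∀ᶠ i in atTop, ∀ k ∈ {k | k ≤ b ∧ σ b ∈ V k}, r * e i ∉ W k := by
        rw [eventually_all_finite ((finite_Iic b).subset fun k hk => hk.1)]
        exact fun k hk => hVW k r (mem_iInter₂.1 hrV k hk)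
      filter_upwards [hr, hev] with i h1 h2
      exact mem_iUnion.2 ⟨b, h1, fun k hk hσk => h2 k ⟨hk, hσk⟩⟩
  obtain ⟨Z, hZf, hZF, hZ⟩ := closure_minimal hRP hPc hR
  refine ⟨Z, hZf.isClosed, hZF, fun V hV => ?_⟩
  obtain ⟨r, hr, h⟩ := hZ V hV
  exact ⟨r, hr, 1, mem_of_mem_nhds hV, by simpa using h⟩

/-- Otherwise `closure S` has escaping sequences arbitrarily near `g`. As `F m` is nowhere dense,
the `r` with `r * g ∉ F m` are dense; a crossing sequence chosen against an enumeration of them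
escapes and is eventually moved off `F m` by each, hence is movable. -/
theorem exists_nhds_forall_not_isEscaping (hnF : ¬ FrechetUrysohnSpace G) {F : ℕ → Set G}
    (hF : IsCapturingScale F) {S : Set G} (hS : S ∈ immovableIdeal F) (g : G) :
    ∃ W ∈ 𝓝 g, ∀ e : ℕ → G, (∀ i, e i ∈ closure S ∩ W) → ¬ IsEscaping e := by
  by_contra! hcon
  obtain ⟨m, hm⟩ := hS
  have hR : Dense {r | r * g ∉ F m} :=
    (interior_eq_empty_iff_dense_compl.1 (hF.interior_eq m)).preimage (isOpenMap_mul_right g)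
  obtain ⟨r, hr⟩ := (to_countable {r | r * g ∉ F m}).exists_eq_range hR.nonempty
  have hrg : ∀ s, r s * g ∉ F m := fun s => by
    have : r s ∈ {r | r * g ∉ F m} := hr ▸ mem_range_self s
    exact this
  have hW : ∀ i, (⋂ s ∈ Iic i, {y | r s * y ∉ F m}) ∈ 𝓝 g := fun i =>
    (biInter_mem (finite_Iic i)).2 fun s _ =>
      (continuous_const_mul (r s)).continuousAt.preimage_mem_nhds
        ((hF.isClosed m).isOpen_compl.mem_nhds (hrg s))
  choose E hES hE using fun i => hcon _ (hW i)
  obtain ⟨φ, a, hφ, hesc⟩ := exists_crossing_isEscaping hnF hE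
  refine hm _ (fun s => (hES (φ s) (a s)).1) (hesc.isMovable (hR 1) ?_)
  rw [hr]
  rintro _ ⟨t, rfl⟩
  filter_upwards [hφ.tendsto_atTop.eventually_ge_atTop t] with s hs
  exact mem_iInter₂.1 (hES (φ s) (a s)).2 t hs

end NonFrechet

/-- A sequence captured by an immovable set is captured by its closure near the limit, where it is
compact; there are only countably many sets and limits. -/
theorem exists_isCompact_capturing (hIIA : InvariantIdealAxiom) {G : Type} [Group G]
    [TopologicalSpace G] [IsTopologicalGroup G] [T1Space G] [Countable G] [SequentialSpace G]
    (hnF : ¬ FrechetUrysohnSpace G) :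
    ∃ S : Set (Set G), S.Countable ∧ (∀ A ∈ S, IsCompact A) ∧ IsCapturing S := by
  have hd : ¬ DiscreteTopology G := fun _ => hnF inferInstance
  have hcg : ¬ (𝓝 (1 : G)).IsCountablyGenerated := by
    intro h
    have := firstCountableTopology_of_isCountablyGenerated h
    exact hnF inferInstance
  obtain ⟨S, hS, hcl, hcap⟩ := (isCountablyGenerated_or_exists_capturing hIIA hd).resolve_left hcg
  obtain ⟨F, hF⟩ := exists_isCapturingScale hd hS hcl hcap
  obtain ⟨T, hT, hTI, hTcap⟩ := hasSeqCapturing_immovableIdeal hIIA hd hF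
  have hex : ∀ A : T, ∀ g : G, ∃ K ∈ 𝓝 g, IsCompact (closure (A : Set G) ∩ K) := by
    intro A g
    obtain ⟨W, hW, hWe⟩ := exists_nhds_forall_not_isEscaping hnF hF (hTI A.2) g
    obtain ⟨K, hK, hKc, hKW⟩ := exists_mem_nhds_isClosed_subset hW
    refine ⟨K, hK, isCompact_of_forall_not_isEscaping (isClosed_closure.inter hKc)
      (to_countable _) fun e he => hWe e fun i => ⟨(he i).1, hKW (he i).2⟩⟩
  choose K hK hKc using hex
  have := hT.to_subtype
  refine ⟨range fun p : T × G => closure (p.1 : Set G) ∩ K p.1 p.2, countable_range _, ?_, ?_⟩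
  · rintro _ ⟨⟨A, g⟩, rfl⟩
    exact hKc A g
  · intro C x hC
    obtain ⟨A, hA, hCA⟩ := hTcap C x hC
    refine ⟨_, ⟨(⟨A, hA⟩, x), rfl⟩, fun hfin => hCA ?_⟩
    refine (hfin.union (hC.almost_subset _ (hK ⟨A, hA⟩ x))).subset ?_
    rintro y ⟨hyC, hyA⟩
    by_cases hyK : y ∈ K ⟨A, hA⟩ x
    · exact Or.inl ⟨hyC, subset_closure hyA, hyK⟩
    · exact Or.inr ⟨hyC, hyK⟩

/-! ### k_ω-spaces and their products. -/

/-- The topology is determined by an increasing sequence of compact sets covering the space. -/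
def IsKOmegaSpace (X : Type*) [TopologicalSpace X] : Prop :=
  ∃ K : ℕ → Set X, Monotone K ∧ (∀ n, IsCompact (K n)) ∧ (∀ x, ∃ n, x ∈ K n) ∧
    ∀ A : Set X, (∀ n, IsClosed (A ∩ K n)) → IsClosed A

section KOmega

variable {X : Type*} [TopologicalSpace X]

theorem isKOmegaSpace_of_isCapturing [SequentialSpace X] [T1Space X] [Countable X]
    {S : Set (Set X)} (hS : S.Countable) (hc : ∀ A ∈ S, IsCompact A) (hcap : IsCapturing S) :
    IsKOmegaSpace X := by
  obtain ⟨K, hmono, hK, hSK⟩ := exists_monotone_cofinal (P := IsCompact) isCompact_empty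
    (fun A B hA hB => hA.union hB) (hS.union (countable_range fun x : X => ({x} : Set X))) (by
      rintro A (hA | ⟨x, rfl⟩)
      · exact hc A hA
      · exact isCompact_singleton)
  refine ⟨K, hmono, hK, fun x => ?_, fun A hA => ?_⟩
  · obtain ⟨n, hn⟩ := hSK {x} (Or.inr ⟨x, rfl⟩)
    exact ⟨n, hn rfl⟩
  · refine isClosed_of_seqConvergesTo fun C x hCA hC => ?_
    obtain ⟨B, hB, hCB⟩ := hcap C x hC
    obtain ⟨n, hn⟩ := hSK B (Or.inl hB)
    have hx : x ∈ closure (A ∩ K n) :=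
      hC.mem_closure (hCB.mono fun y hy => ⟨hy.1, hCA hy.1, hn hy.2⟩)
    rw [(hA n).closure_eq] at hx
    exact hx.1

theorem isKOmegaSpace_of_discreteTopology [DiscreteTopology X] [Countable X] :
    IsKOmegaSpace X := by
  refine isKOmegaSpace_of_isCapturing countable_empty (by simp) fun C x hC => ?_
  refine absurd ?_ hC.infinite
  refine ((hC.almost_subset {x} (by simp)).union (finite_singleton x)).subset fun y hy => ?_
  by_cases h : y = x
  · exact Or.inr h
  · exact Or.inl ⟨hy, h⟩

theorem IsKOmegaSpace.of_homeomorph {Y : Type*} [TopologicalSpace Y] (e : X ≃ₜ Y)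
    (h : IsKOmegaSpace X) : IsKOmegaSpace Y := by
  obtain ⟨K, hmono, hK, hcov, hdet⟩ := h
  refine ⟨fun n => e '' K n, fun m n hmn => image_mono (hmono hmn),
    fun n => (hK n).image e.continuous, fun y => ?_, fun A hA => ?_⟩
  · obtain ⟨n, hn⟩ := hcov (e.symm y)
    exact ⟨n, _, hn, e.apply_symm_apply y⟩
  · rw [← e.isClosed_preimage]
    refine hdet _ fun n => ?_
    have := (hA n).preimage e.continuous
    rwa [preimage_inter, preimage_image_eq _ e.injective] at this

/-- In a countable Hausdorff space the neighbourhoods of a point relative to a compact set are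
countably generated. -/
theorem IsCompact.isCountablyGenerated_nhdsWithin [T2Space X] [Countable X] {K : Set X}
    (hK : IsCompact K) (x : X) : (𝓝[K] x).IsCountablyGenerated := by
  have hU : ∀ y : X, ∃ U ∈ 𝓝 x, y ≠ x → y ∉ closure U := by
    intro y
    by_cases hy : y = x
    · exact ⟨univ, univ_mem, fun h => absurd hy h⟩
    · obtain ⟨U, V, hU, hV, hxU, hyV, hUV⟩ := t2_separation (Ne.symm hy)
      refine ⟨U, hU.mem_nhds hxU, fun _ hcl => ?_⟩
      exact (hUV.symm.closure_right hV).notMem_of_mem_left hyV hcl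
  choose U hU hUy using hU
  -- This countably generated filter clusters at no `y ≠ x`, since `closure (U y)` misses `y`; by
  -- compactness of `K` it converges to `x`.
  have hle : (⨅ y, 𝓟 (U y)) ⊓ 𝓟 K ≤ 𝓝 x := by
    refine hK.le_nhds_of_unique_clusterPt (mem_inf_of_right (mem_principal_self K)) fun y _ hy => ?_
    by_contra hne
    refine hUy y hne (mem_closure_iff_clusterPt.2 (hy.mono ?_))
    exact inf_le_left.trans (iInf_le _ y)
  have : 𝓝[K] x = (⨅ y, 𝓟 (U y)) ⊓ 𝓟 K := by
    refine le_antisymm (inf_le_inf_right _ (le_iInf fun y => le_principal_iff.2 (hU y))) ?_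
    exact le_inf hle inf_le_right
  rw [this]
  infer_instance

/-- Closedness is tested on each `K n`, where relative neighbourhood filters are countably generated
and sequences suffice. -/
theorem IsKOmegaSpace.sequentialSpace [T2Space X] [Countable X] (h : IsKOmegaSpace X) :
    SequentialSpace X := by
  obtain ⟨K, -, hK, -, hdet⟩ := h
  refine ⟨fun A hA => hdet A fun n => ?_⟩
  have := (hK n).isCountablyGenerated_nhdsWithin
  refine isClosed_of_closure_subset fun x hx => ?_
  have hne : NeBot (𝓝[K n] x ⊓ 𝓟 A) := by
    have := mem_closure_iff_nhdsWithin_neBot.1 hx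
    rwa [inter_comm, nhdsWithin_inter'] at this
  obtain ⟨u, hu⟩ := exists_seq_tendsto (𝓝[K n] x ⊓ 𝓟 A)
  have hux : Tendsto u atTop (𝓝 x) := hu.mono_right (inf_le_left.trans inf_le_left)
  have huA : ∀ᶠ i in atTop, u i ∈ A := hu (mem_inf_of_right (mem_principal_self A))
  refine ⟨?_, (hK n).isClosed.closure_subset_iff.2 inter_subset_right hx⟩
  obtain ⟨N, hN⟩ := eventually_atTop.1 huA
  exact hA (fun i => hN (i + N) (Nat.le_add_left _ _)) (hux.comp (tendsto_add_atTop_nat N))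

/-- An increasing union of compact sets, each of which is a relative neighbourhood of the preceding
one, is open. -/
theorem isOpen_iUnion_of_relative_nhds [T2Space X] {K B O : ℕ → Set X} (hmono : Monotone K)
    (hK : ∀ n, IsCompact (K n)) (hdet : ∀ A : Set X, (∀ n, IsClosed (A ∩ K n)) → IsClosed A)
    (hO : ∀ n, IsOpen (O n)) (hBO : ∀ n, B n ⊆ O n) (hOB : ∀ n, O n ∩ K (n + 1) ⊆ B (n + 1))
    (hBK : ∀ n, B n ⊆ K n) : IsOpen (⋃ n, B n) := by
  have hBmono : Monotone B := monotone_nat_of_le_succ fun n x hx =>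
    hOB n ⟨hBO n hx, hmono n.le_succ (hBK n hx)⟩
  rw [← isClosed_compl_iff]
  refine hdet _ fun m => ?_
  -- Inside `K m` the union of the `B n` agrees with the open union of the `O n`, `n ≥ m`, because
  -- `K m ⊆ K (n + 1)`.
  have : (⋃ n, B n)ᶜ ∩ K m = K m ∩ (⋃ n ≥ m, O n)ᶜ := by
    ext x
    simp only [mem_inter_iff, mem_compl_iff, mem_iUnion, not_exists]
    constructor
    · rintro ⟨h1, h2⟩
      exact ⟨h2, fun n hn hx => h1 (n + 1) (hOB n ⟨hx, hmono (Nat.le_succ_of_le hn) h2⟩)⟩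
    · rintro ⟨h1, h2⟩
      exact ⟨fun n hx => h2 (max n m) (le_max_right _ _) (hBO _ (hBmono (le_max_left _ _) hx)), h1⟩
  rw [this]
  exact (hK m).isClosed.inter (isOpen_biUnion fun n _ => hO n).isClosed_compl

/-- A compact box missing `A` grows, by the tube lemma and regularity, to a box in the next stage
that is a relative neighbourhood of it. The unions of the sides are open and their product misses
`A`. -/
theorem IsKOmegaSpace.prod {Y : Type*} [TopologicalSpace Y] [T3Space X] [T3Space Y]
    (hX : IsKOmegaSpace X) (hY : IsKOmegaSpace Y) : IsKOmegaSpace (X × Y) := by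
  obtain ⟨K, hKmono, hK, hKcov, hKdet⟩ := hX
  obtain ⟨L, hLmono, hL, hLcov, hLdet⟩ := hY
  refine ⟨fun n => K n ×ˢ L n, fun m n hmn => prod_mono (hKmono hmn) (hLmono hmn),
    fun n => (hK n).prod (hL n), ?_, fun A hA => ?_⟩
  · rintro ⟨x, y⟩
    obtain ⟨m, hm⟩ := hKcov x
    obtain ⟨n, hn⟩ := hLcov y
    exact ⟨max m n, hKmono (le_max_left _ _) hm, hLmono (le_max_right _ _) hn⟩
  rw [← isOpen_compl_iff, isOpen_iff_mem_nhds]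
  rintro ⟨x, y⟩ hxy
  -- boxes missing `A`, together with open sets whose traces lie in the next box
  let Box (N : ℕ) := {p : Set X × Set Y // IsCompact p.1 ∧ IsCompact p.2 ∧ p.1 ⊆ K N ∧ p.2 ⊆ L N ∧
    Disjoint (p.1 ×ˢ p.2) A}
  obtain ⟨N, hxN, hyN⟩ : ∃ N, x ∈ K N ∧ y ∈ L N := by
    obtain ⟨m, hm⟩ := hKcov x
    obtain ⟨n, hn⟩ := hLcov y
    exact ⟨max m n, hKmono (le_max_left _ _) hm, hLmono (le_max_right _ _) hn⟩
  have hstep : ∀ (n : ℕ) (p : Box (N + n)), ∃ (q : Box (N + (n + 1))) (O : Set X) (O' : Set Y),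
      IsOpen O ∧ IsOpen O' ∧ p.1.1 ⊆ O ∧ p.1.2 ⊆ O' ∧ O ∩ K (N + (n + 1)) ⊆ q.1.1 ∧
      O' ∩ L (N + (n + 1)) ⊆ q.1.2 := by
    rintro n ⟨⟨B, D⟩, hB, hD, hBK, hDL, hdisj⟩
    dsimp only at hB hD hBK hDL hdisj ⊢
    obtain ⟨U, V, hU, hV, hBU, hDV, hUV⟩ := generalized_tube_lemma hB hD
      (hA (N + (n + 1))).isOpen_compl fun z hz hzA => hdisj.notMem_of_mem_left hz hzA.1
    obtain ⟨O, hO, hBO, hOU⟩ := hB.exists_isOpen_closure_subset (hU.mem_nhdsSet.2 hBU)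
    obtain ⟨O', hO', hDO', hOV⟩ := hD.exists_isOpen_closure_subset (hV.mem_nhdsSet.2 hDV)
    refine ⟨⟨(closure O ∩ K (N + (n + 1)), closure O' ∩ L (N + (n + 1))),
      (hK _).inter_left isClosed_closure, (hL _).inter_left isClosed_closure, inter_subset_right,
      inter_subset_right, ?_⟩, O, O', hO, hO', hBO, hDO',
      inter_subset_inter_left _ subset_closure, inter_subset_inter_left _ subset_closure⟩
    rw [disjoint_left]
    rintro ⟨a, b⟩ ⟨⟨ha, haK⟩, hb, hbL⟩ hab
    exact hUV (mk_mem_prod (hOU ha) (hOV hb)) ⟨hab, haK, hbL⟩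
  choose next O O' hO hO' hBO hDO hOB hOD using hstep
  let p : (n : ℕ) → Box (N + n) := fun n =>
    Nat.rec ⟨({x}, {y}), isCompact_singleton, isCompact_singleton, by simpa using hxN,
      by simpa using hyN, by simpa using hxy⟩ next n
  have hp : ∀ n, p (n + 1) = next n (p n) := fun n => rfl
  have hKm : Monotone fun n => K (N + n) := fun m n hmn => hKmono (by omega)
  have hLm : Monotone fun n => L (N + n) := fun m n hmn => hLmono (by omega)
  have hKd : ∀ A : Set X, (∀ n, IsClosed (A ∩ K (N + n))) → IsClosed A := fun A hA =>
    hKdet A fun n => by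
      have := (hA n).inter (hK n).isClosed
      rwa [inter_assoc, inter_eq_right.2 (hKmono (Nat.le_add_left n N))] at this
  have hLd : ∀ A : Set Y, (∀ n, IsClosed (A ∩ L (N + n))) → IsClosed A := fun A hA =>
    hLdet A fun n => by
      have := (hA n).inter (hL n).isClosed
      rwa [inter_assoc, inter_eq_right.2 (hLmono (Nat.le_add_left n N))] at this
  have hBopen : IsOpen (⋃ n, (p n).1.1) :=
    isOpen_iUnion_of_relative_nhds hKm (fun n => hK _) hKd (fun n => hO n (p n))
      (fun n => hBO n (p n)) (fun n => hOB n (p n)) fun n => (p n).2.2.2.1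
  have hDopen : IsOpen (⋃ n, (p n).1.2) :=
    isOpen_iUnion_of_relative_nhds hLm (fun n => hL _) hLd (fun n => hO' n (p n))
      (fun n => hDO n (p n)) (fun n => hOD n (p n)) fun n => (p n).2.2.2.2.1
  have hBm : Monotone fun n => (p n).1.1 := monotone_nat_of_le_succ fun n z hz =>
    hOB n (p n) ⟨hBO n (p n) hz, hKm n.le_succ ((p n).2.2.2.1 hz)⟩
  have hDm : Monotone fun n => (p n).1.2 := monotone_nat_of_le_succ fun n z hz =>
    hOD n (p n) ⟨hDO n (p n) hz, hLm n.le_succ ((p n).2.2.2.2.1 hz)⟩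
  refine mem_of_superset ((hBopen.prod hDopen).mem_nhds
    ⟨mem_iUnion.2 ⟨0, rfl⟩, mem_iUnion.2 ⟨0, rfl⟩⟩) ?_
  rintro ⟨a, b⟩ ⟨ha, hb⟩
  obtain ⟨m, hm⟩ := mem_iUnion.1 ha
  obtain ⟨n, hn⟩ := mem_iUnion.1 hb
  exact (p (max m n)).2.2.2.2.2.notMem_of_mem_left
    (mk_mem_prod (hBm (le_max_left _ _) hm) (hDm (le_max_right _ _) hn))

theorem isKOmegaSpace_pi {ι : Type*} [Finite ι] : ∀ (X : ι → Type*) [∀ i, TopologicalSpace (X i)]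
    [∀ i, T3Space (X i)], (∀ i, IsKOmegaSpace (X i)) → IsKOmegaSpace (∀ i, X i) := by
  refine Finite.induction_empty_option (P := fun ι => ∀ (X : ι → Type _)
    [∀ i, TopologicalSpace (X i)] [∀ i, T3Space (X i)], (∀ i, IsKOmegaSpace (X i)) →
      IsKOmegaSpace (∀ i, X i)) ?_ ?_ ?_ ι
  · intro α β e ih X _ _ hX
    exact (ih (fun a => X (e a)) fun a => hX (e a)).of_homeomorph (Homeomorph.piCongrLeft e)
  · intro X _ _ _
    exact isKOmegaSpace_of_discreteTopology
  · intro α _ ih X _ _ hX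
    have h := (hX none).prod (ih (fun a => X (some a)) fun a => hX (some a))
    refine h.of_homeomorph
      { toEquiv := Equiv.piOptionEquivProd.symm
        continuous_toFun := continuous_pi fun a => ?_
        continuous_invFun := ?_ }
    · cases a with
      | none => exact continuous_fst
      | some a => exact (continuous_apply a).comp continuous_snd
    · exact (continuous_apply none).prodMk (continuous_pi fun a => continuous_apply (some a))

end KOmega

/-! ### Change of universe and passage to separable groups. -/

section Transport

variable {G : Type*} [Group G] [TopologicalSpace G] [IsTopologicalGroup G]

/-- The axiom concerns groups in `Type`; countable groups of any universe are small and are moved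
there by `Shrink`. -/
theorem isTopologicalGroup_shrink [Small.{0} G] : IsTopologicalGroup (Shrink.{0} G) :=
  topologicalGroup_induced (Shrink.mulEquiv (α := G))

theorem firstCountableTopology_of_countable_frechetUrysohnSpace (hIIA : InvariantIdealAxiom)
    [T1Space G] [Countable G] [FrechetUrysohnSpace G] : FirstCountableTopology G := by
  have := isTopologicalGroup_shrink (G := G)
  let e : G ≃ₜ Shrink.{0} G := Shrink.homeomorph.{0} G
  have : Countable (Shrink.{0} G) := e.symm.injective.countable
  have : T1Space (Shrink.{0} G) := e.symm.isEmbedding.t1Space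
  have : FrechetUrysohnSpace (Shrink.{0} G) := e.symm.isInducing.frechetUrysohnSpace
  have : FirstCountableTopology (Shrink.{0} G) :=
    firstCountableTopology_of_isCountablyGenerated
      (isCountablyGenerated_of_frechetUrysohnSpace hIIA)
  exact e.isInducing.firstCountableTopology

/-- A countable dense subgroup inherits the Fréchet property, so it is first countable; by
regularity the closures in `G` of its basic neighbourhoods of 1 form a base at 1. -/
theorem firstCountableTopology_of_separable_frechetUrysohnSpace (hIIA : InvariantIdealAxiom)
    [T1Space G] [TopologicalSpace.SeparableSpace G] [FrechetUrysohnSpace G] :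
    FirstCountableTopology G := by
  obtain ⟨D, hD, hDd⟩ := TopologicalSpace.exists_countable_dense G
  have := hD.to_subtype
  set H : Subgroup G := (FreeGroup.lift (Subtype.val : D → G)).range with hH
  have hDH : D ⊆ (H : Set G) := fun x hx => ⟨FreeGroup.of ⟨x, hx⟩, by simp⟩
  have hHc : (H : Set G).Countable := by
    rw [hH, MonoidHom.coe_range]
    exact countable_range _
  have : Countable H := hHc.to_subtype
  have hHd : Dense (H : Set G) := hDd.mono hDH
  have : FirstCountableTopology H :=
    firstCountableTopology_of_countable_frechetUrysohnSpace hIIA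
  obtain ⟨B, hB⟩ := (𝓝 (1 : H)).exists_antitone_basis
  have hb := hB.1.hasBasis_of_isDenseInducing hHd.isDenseInducing_val
  exact firstCountableTopology_of_isCountablyGenerated
    (HasCountableBasis.isCountablyGenerated ⟨hb, to_countable _⟩)

theorem isKOmegaSpace_of_not_frechetUrysohnSpace (hIIA : InvariantIdealAxiom)
    [T1Space G] [Countable G] [SequentialSpace G] (hnF : ¬ FrechetUrysohnSpace G) :
    IsKOmegaSpace G := by
  have := isTopologicalGroup_shrink (G := G)
  let e : G ≃ₜ Shrink.{0} G := Shrink.homeomorph.{0} G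
  have : Countable (Shrink.{0} G) := e.symm.injective.countable
  have : T1Space (Shrink.{0} G) := e.symm.isEmbedding.t1Space
  have : SequentialSpace (Shrink.{0} G) := e.isQuotientMap.sequentialSpace
  have hnF' : ¬ FrechetUrysohnSpace (Shrink.{0} G) := fun _ =>
    hnF e.isInducing.frechetUrysohnSpace
  obtain ⟨S, hS, hc, hcap⟩ := exists_isCompact_capturing hIIA hnF'
  exact (isKOmegaSpace_of_isCapturing hS hc hcap).of_homeomorph e.symm

end Transport

theorem mainTheorem5 (hIIA : InvariantIdealAxiom) :
    (∀ (ι : Type*) [Countable ι] (G : ι → Type*) [∀ i, Group (G i)]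
        [∀ i, TopologicalSpace (G i)] [∀ i, IsTopologicalGroup (G i)] [∀ i, T1Space (G i)]
        [∀ i, TopologicalSpace.SeparableSpace (G i)] [∀ i, FrechetUrysohnSpace (G i)],
        FrechetUrysohnSpace (∀ i, G i)) ∧
    (∀ (ι : Type*) [Finite ι] (G : ι → Type*) [∀ i, Group (G i)]
        [∀ i, TopologicalSpace (G i)] [∀ i, IsTopologicalGroup (G i)] [∀ i, T1Space (G i)]
        [∀ i, Countable (G i)] [∀ i, SequentialSpace (G i)],
        (∀ i, DiscreteTopology (G i) ∨ ¬ FrechetUrysohnSpace (G i)) →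
        SequentialSpace (∀ i, G i)) := by
  constructor
  · intro ι _ G _ _ _ _ _ _
    have := fun i => firstCountableTopology_of_separable_frechetUrysohnSpace (G := G i) hIIA
    infer_instance
  · intro ι _ G _ _ _ _ _ _ h
    refine (isKOmegaSpace_pi G fun i => ?_).sequentialSpace
    rcases h i with hd | hnF
    · exact isKOmegaSpace_of_discreteTopology
    · exact isKOmegaSpace_of_not_frechetUrysohnSpace hIIA hnF
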